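/- Let $(M^{2m},J,g)$ be a locally conformal Kähler manifold with Lee form $\omega$: $J$ is an integrable complex structure on the smooth manifold $M$, $g$ is a Riemannian metric with $g(JX,JY)=g(X,Y)$, and every point of $M$ has an open neighbourhood $U$ with a smooth function $f:U\to\mathbb R$ such that the metric $e^{-f}g$ is Kähler on $U$ (that is, its fundamental form $e^{-f}g(\cdot,J\cdot)$ is closed) and $\omega|_U=df$. Let $B=\omega^{\sharp}$ be the Lee vector field, $g(B,X)=\omega(X)$. Let $K\subset M$ be a complex submanifold (embedded or only immersed), i.e. $J(T_pK)\subseteq T_pK$ for all $p\in K$, of complex dimension $n=\dim_{\mathbb C}K$. Let $\nabla$ be the Levi-Civita connection of $g$, let $A(X,Y)=(\nabla_XY)^{\perp}$ be the second fundamental form of $K$, where $\perp$ denotes the orthogonal projection to the normal space $(T_pK)^{\perp}$, and let $\mathrm{trace}\,A$ be its trace with respect to the metric induced on $K$. For a smooth vector field $V$ on $M$, the submanifold $K$ is called $V$-minimal if $\mathrm{trace}(A)-V$ is tangent to $K$ at every point of $K$. Then $V=-nB$ is a smooth vector field on $M$ and $K$ is $V$-minimal for $V=-nB$; moreover $\mathrm{trace}\,A=-n\,B^{\perp}$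 along $K$. -/

import Mathlib

open Bundle FiberBundle VectorField
open scoped Manifold ContDiff Topology InnerProductSpace

namespace LCK

noncomputable section

variable {E : Type*} [NormedAddCommGroup E] [NormedSpace ℝ E] [FiniteDimensional ℝ E]
  {M : Type*} [TopologicalSpace M] [ChartedSpace E M] [IsManifold 𝓘(ℝ, E) ∞ M]
  [RiemannianBundle (fun x : M ↦ TangentSpace 𝓘(ℝ, E) x)]
  [IsContMDiffRiemannianBundle 𝓘(ℝ, E) ∞ E (fun x : M ↦ TangentSpace 𝓘(ℝ, E) x)]

instance finiteDimensional_tangentSpace (x : M) : FiniteDimensional ℝ (TangentSpace 𝓘(ℝ, E) x) :=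
  inferInstanceAs (FiniteDimensional ℝ E)

/-- The Koszul expression: for the Levi-Civita connection `∇` one has
`⟪∇_X Y, Z⟫ = 1/2 (X⟪Y,Z⟫ + Y⟪X,Z⟫ - Z⟪X,Y⟫ + ⟪[X,Y],Z⟫ - ⟪[X,Z],Y⟫ - ⟪[Y,Z],X⟫)`. -/
def koszul (X Y Z : Π x : M, TangentSpace 𝓘(ℝ, E) x) (x : M) : ℝ :=
  (1 / 2 : ℝ) *
    (d% (fun y ↦ ⟪Y y, Z y⟫_ℝ) x (X x) + d% (fun y ↦ ⟪X y, Z y⟫_ℝ) x (Y x)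
      - d% (fun y ↦ ⟪X y, Y y⟫_ℝ) x (Z x)
      + ⟪mlieBracket 𝓘(ℝ, E) X Y x, Z x⟫_ℝ - ⟪mlieBracket 𝓘(ℝ, E) X Z x, Y x⟫_ℝ
      - ⟪mlieBracket 𝓘(ℝ, E) Y Z x, X x⟫_ℝ)

/-- The inner product of two differentiable vector fields is differentiable. -/
theorem mdiffAt_inner {X Y : Π x : M, TangentSpace 𝓘(ℝ, E) x} {x : M}
    (hX : MDiffAt (T% X) x) (hY : MDiffAt (T% Y) x) :
    MDiffAt (fun y ↦ ⟪X y, Y y⟫_ℝ) x :=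
  MDifferentiableAt.inner_bundle (E := fun x : M ↦ TangentSpace 𝓘(ℝ, E) x) (IB := 𝓘(ℝ, E))
    (F := E) (b := fun x ↦ x) hX hY

theorem tensorialAt_koszul_left (Y Z : Π x : M, TangentSpace 𝓘(ℝ, E) x) {x : M}
    (hY : MDiffAt (T% Y) x) (hZ : MDiffAt (T% Z) x) :
    TensorialAt 𝓘(ℝ, E) E (fun X ↦ koszul X Y Z x) x where
  smul {f X} hf hX := by
    have : CompleteSpace E := FiniteDimensional.complete ℝ E
    simp [koszul, mlieBracket_smul_left hf hX, mvfderiv_fun_mul hf (mdiffAt_inner hX hY),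
      mvfderiv_fun_mul hf (mdiffAt_inner hX hZ), inner_smul_left, inner_smul_right, inner_add_left]
    rw [real_inner_comm (Y x) (X x), real_inner_comm (Z x) (X x)]
    ring
  add {X X'} hX hX' := by
    have : CompleteSpace E := FiniteDimensional.complete ℝ E
    simp [koszul, mlieBracket_add_left hX hX', inner_add_left, inner_add_right,
      mvfderiv_fun_add (mdiffAt_inner hX hY) (mdiffAt_inner hX' hY),
      mvfderiv_fun_add (mdiffAt_inner hX hZ) (mdiffAt_inner hX' hZ)]
    ring

theorem tensorialAt_koszul_right (X Y : Π x : M, TangentSpace 𝓘(ℝ, E) x) {x : M}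
    (hX : MDiffAt (T% X) x) (hY : MDiffAt (T% Y) x) :
    TensorialAt 𝓘(ℝ, E) E (fun Z ↦ koszul X Y Z x) x where
  smul {f Z} hf hZ := by
    have : CompleteSpace E := FiniteDimensional.complete ℝ E
    simp [koszul, mlieBracket_smul_right hf hZ, mvfderiv_fun_mul hf (mdiffAt_inner hX hZ),
      mvfderiv_fun_mul hf (mdiffAt_inner hY hZ), inner_smul_left, inner_smul_right, inner_add_left]
    rw [real_inner_comm (X x) (Z x), real_inner_comm (Y x) (Z x)]
    ring
  add {Z Z'} hZ hZ' := by
    have : CompleteSpace E := FiniteDimensional.complete ℝ E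
    simp [koszul, mlieBracket_add_right hZ hZ', inner_add_left, inner_add_right,
      mvfderiv_fun_add (mdiffAt_inner hX hZ) (mdiffAt_inner hX hZ'),
      mvfderiv_fun_add (mdiffAt_inner hY hZ) (mdiffAt_inner hY hZ')]
    ring

open Classical in
/-- The covariant derivative `v ↦ ∇_v Y` at `x`, defined by the Koszul formula
(junk value `0` where `Y` is not differentiable). -/
def leviCivitaFun (Y : Π x : M, TangentSpace 𝓘(ℝ, E) x) (x : M) :
    TangentSpace 𝓘(ℝ, E) x →L[ℝ] TangentSpace 𝓘(ℝ, E) x :=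
  if hY : MDiffAt (T% Y) x then
    haveI : CompleteSpace (TangentSpace 𝓘(ℝ, E) x) := FiniteDimensional.complete ℝ _
    InnerProductSpace.continuousLinearMapOfBilin (𝕜 := ℝ)
      (TensorialAt.mkHom₂ (fun X Z ↦ koszul X Y Z x) x
        (fun Z hZ ↦ tensorialAt_koszul_left Y Z hY hZ)
        (fun X hX ↦ tensorialAt_koszul_right X Y hX hY))
  else 0

theorem inner_leviCivitaFun {X Y Z : Π x : M, TangentSpace 𝓘(ℝ, E) x} {x : M}
    (hX : MDiffAt (T% X) x) (hY : MDiffAt (T% Y) x) (hZ : MDiffAt (T% Z) x) :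
    ⟪leviCivitaFun Y x (X x), Z x⟫_ℝ = koszul X Y Z x := by
  have : CompleteSpace (TangentSpace 𝓘(ℝ, E) x) := FiniteDimensional.complete ℝ _
  rw [leviCivitaFun, dif_pos hY]
  exact (InnerProductSpace.continuousLinearMapOfBilin_apply _ _ _).trans
    (TensorialAt.mkHom₂_apply _ _ hX hZ)

theorem leviCivitaFun_eq {Y : Π x : M, TangentSpace 𝓘(ℝ, E) x} {x : M} (hY : MDiffAt (T% Y) x)
    {L : TangentSpace 𝓘(ℝ, E) x →L[ℝ] TangentSpace 𝓘(ℝ, E) x}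
    (h : ∀ X Z : Π x : M, TangentSpace 𝓘(ℝ, E) x, MDiffAt (T% X) x → MDiffAt (T% Z) x →
      ⟪L (X x), Z x⟫_ℝ = koszul X Y Z x) :
    leviCivitaFun Y x = L := by
  refine ContinuousLinearMap.ext fun v ↦ ext_inner_right ℝ fun w ↦ ?_
  have hv := mdifferentiableAt_extend 𝓘(ℝ, E) E v
  have hw := mdifferentiableAt_extend 𝓘(ℝ, E) E w
  have h1 := h _ _ hv hw
  rw [← inner_leviCivitaFun hv hY hw] at h1
  simpa using h1.symm

/-- The Levi-Civita connection of the Riemannian manifold `M`. In Mathlib's argument order,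
`leviCivita Y x v` is `(∇_v Y)(x)`. -/
def leviCivita : CovariantDerivative 𝓘(ℝ, E) E (TangentSpace 𝓘(ℝ, E) : M → Type _) where
  toFun := leviCivitaFun
  isCovariantDerivativeOnUniv :=
    { add := fun {Y Y' x} hY hY' _ ↦ by
        have : CompleteSpace E := FiniteDimensional.complete ℝ E
        refine leviCivitaFun_eq (mdifferentiableAt_add_section hY hY') fun X Z hX hZ ↦ ?_
        rw [_root_.add_apply, inner_add_left, inner_leviCivitaFun hX hY hZ,
          inner_leviCivitaFun hX hY' hZ]
        simp [koszul, mlieBracket_add_right hY hY', mlieBracket_add_left hY hY', inner_add_left,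
          inner_add_right, mvfderiv_fun_add (mdiffAt_inner hX hY) (mdiffAt_inner hX hY'),
          mvfderiv_fun_add (mdiffAt_inner hY hZ) (mdiffAt_inner hY' hZ)]
        ring
      leibniz := fun {Y f x} hY hf _ ↦ by
        have : CompleteSpace E := FiniteDimensional.complete ℝ E
        refine leviCivitaFun_eq (hf.smul_section hY) fun X Z hX hZ ↦ ?_
        rw [_root_.add_apply, inner_add_left, _root_.smul_apply,
          inner_smul_left, inner_leviCivitaFun hX hY hZ]
        simp [koszul, mlieBracket_smul_right hf hY, mlieBracket_smul_left hf hY, inner_add_left,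
          inner_smul_left, inner_smul_right, mvfderiv_fun_mul hf (mdiffAt_inner hX hY),
          mvfderiv_fun_mul hf (mdiffAt_inner hY hZ)]
        rw [real_inner_comm (X x) (Y x)]
        ring }

/-- The Levi-Civita connection is torsion-free. -/
theorem leviCivita_torsion :
    haveI : CompleteSpace E := FiniteDimensional.complete ℝ E
    (leviCivita : CovariantDerivative 𝓘(ℝ, E) E (TangentSpace 𝓘(ℝ, E) : M → Type _)).torsion = 0 := by
  have : CompleteSpace E := FiniteDimensional.complete ℝ E
  rw [CovariantDerivative.torsion_eq_zero_iff]
  intro X Y x hX hY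
  refine ext_inner_right ℝ fun w ↦ ?_
  have hw := mdifferentiableAt_extend 𝓘(ℝ, E) E w
  have h1 := inner_leviCivitaFun hX hY hw
  have h2 := inner_leviCivitaFun hY hX hw
  rw [extend_apply_self] at h1 h2
  change ⟪leviCivitaFun Y x (X x) - leviCivitaFun X x (Y x), w⟫_ℝ = _
  rw [inner_sub_left, h1, h2, koszul, koszul, mlieBracket_swap_apply (V := Y) (W := X)]
  simp only [real_inner_comm, inner_neg_right, extend_apply_self]
  ring

/-- The Levi-Civita connection is compatible with the metric. -/
theorem leviCivita_metric {X Y Z : Π x : M, TangentSpace 𝓘(ℝ, E) x} {x : M}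
    (hX : MDiffAt (T% X) x) (hY : MDiffAt (T% Y) x) (hZ : MDiffAt (T% Z) x) :
    d% (fun y ↦ ⟪Y y, Z y⟫_ℝ) x (X x) =
      ⟪leviCivita Y x (X x), Z x⟫_ℝ + ⟪Y x, leviCivita Z x (X x)⟫_ℝ := by
  change _ = ⟪leviCivitaFun Y x (X x), Z x⟫_ℝ + ⟪Y x, leviCivitaFun Z x (X x)⟫_ℝ
  rw [inner_leviCivitaFun hX hY hZ, real_inner_comm, inner_leviCivitaFun hX hZ hY, koszul, koszul,
    mlieBracket_swap_apply (V := Z) (W := Y)]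
  simp only [real_inner_comm, inner_neg_left]
  ring

section Sub
variable {F : Type*} [NormedAddCommGroup F] [NormedSpace ℝ F]
  {K : Type*} [TopologicalSpace K] [ChartedSpace F K] [IsManifold 𝓘(ℝ, F) ∞ K]

/-- The pull-back to `K` along `ι : K → M` of the Levi-Civita connection of `M`, applied at `p` to a
section `s` of `ι^*TM`: if `s = ∑ s^a e_a` in the frame `e_a` of the standard local
trivialization of `TM` at `ι p`, then `∇_v s = ∑ ds^a(v) e_a + ∑ s^a(p) ∇_{dι v} e_a`. The second sum
is the derivative of the extension of `s p` which is constant in that trivialization. -/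
def covariantDerivAlong (ι : K → M) (s : Π q : K, TangentSpace 𝓘(ℝ, E) (ι q)) (p : K) :
    TangentSpace 𝓘(ℝ, F) p →L[ℝ] TangentSpace 𝓘(ℝ, E) (ι p) :=
  letI t := trivializationAt E (TangentSpace 𝓘(ℝ, E) : M → Type _) (ι p)
  (t.symmL ℝ (ι p)) ∘L (d% (fun q ↦ (t ⟨ι q, s q⟩).2) p)
    + (leviCivita (extend E (s p)) (ι p)) ∘L (mfderiv 𝓘(ℝ, F) 𝓘(ℝ, E) ι p)

variable (F)

/-- The tangent space `T_pK`, seen as the subspace `dι_p(T_pK)` of `T_{ι p}M`. -/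
def tangentImage (ι : K → M) (p : K) : Submodule ℝ (TangentSpace 𝓘(ℝ, E) (ι p)) :=
  LinearMap.range (mfderiv 𝓘(ℝ, F) 𝓘(ℝ, E) ι p).toLinearMap

/-- The normal part `u^⊥`: orthogonal projection of `u` to `(T_pK)^⊥`. -/
def normalPart (ι : K → M) (p : K) (u : TangentSpace 𝓘(ℝ, E) (ι p)) :
    TangentSpace 𝓘(ℝ, E) (ι p) :=
  (tangentImage F ι p)ᗮ.starProjection u

/-- The second fundamental form `A(v, w) = (∇^M_v W)^⊥` of `ι : K → M` at `p`, where `W` is a local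
extension of `w` to a vector field tangent to `K`. -/
def secondFundamentalForm (ι : K → M) (p : K) (v w : TangentSpace 𝓘(ℝ, F) p) :
    TangentSpace 𝓘(ℝ, E) (ι p) :=
  normalPart F ι p (covariantDerivAlong ι
    (fun q ↦ mfderiv 𝓘(ℝ, F) 𝓘(ℝ, E) ι q (extend F w q)) p v)

/-- The trace of a bilinear `A` on `T` with respect to the inner product induced on `T` by an
injective linear map `L : T → W` to an inner product space: `∑ A(e_i, e_i)`, where `(L e_i)` is an
orthonormal basis of the image of `L`. -/
def inducedTrace {T W X : Type*} [AddCommGroup T] [Module ℝ T] [NormedAddCommGroup W]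
    [InnerProductSpace ℝ W] [FiniteDimensional ℝ W] [AddCommMonoid X]
    (L : T →ₗ[ℝ] W) (A : T → T → X) : X :=
  letI b := stdOrthonormalBasis ℝ (LinearMap.range L)
  ∑ i, A (b i).2.choose (b i).2.choose

/-- `trace A`, with respect to the metric induced on `K`. -/
def traceSecondFundamentalForm (ι : K → M) (p : K) : TangentSpace 𝓘(ℝ, E) (ι p) :=
  inducedTrace (mfderiv 𝓘(ℝ, F) 𝓘(ℝ, E) ι p).toLinearMap (secondFundamentalForm F ι p)

/-- `K` is `V`-minimal: `trace A - V` is tangent to `K`. -/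
def IsVMinimal (ι : K → M) (V : Π x : M, TangentSpace 𝓘(ℝ, E) x) : Prop :=
  ∀ p : K, traceSecondFundamentalForm F ι p - V (ι p) ∈ tangentImage F ι p

/-- The metric `g` of `M` as a family of bilinear forms. -/
def metricForm (x : M) : TangentSpace 𝓘(ℝ, E) x →L[ℝ] TangentSpace 𝓘(ℝ, E) x →L[ℝ] ℝ :=
  innerSL ℝ

/-- The vector field `θ^♯` dual to a 1-form `θ`: `⟪θ^♯, v⟫ = θ(v)`. -/
def sharp (θ : Π x : M, TangentSpace 𝓘(ℝ, E) x →L[ℝ] ℝ) (x : M) : TangentSpace 𝓘(ℝ, E) x :=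
  haveI : CompleteSpace (TangentSpace 𝓘(ℝ, E) x) := FiniteDimensional.complete ℝ _
  (InnerProductSpace.toDual ℝ (TangentSpace 𝓘(ℝ, E) x)).symm (θ x)

/-- `J` is a complex structure on `M`: a smooth endomorphism field with `J² = -1` and vanishing
Nijenhuis tensor. -/
structure IsComplexStructure (J : Π x : M, TangentSpace 𝓘(ℝ, E) x →L[ℝ] TangentSpace 𝓘(ℝ, E) x) :
    Prop where
  contMDiff : ContMDiff 𝓘(ℝ, E) (𝓘(ℝ, E).prod 𝓘(ℝ, E →L[ℝ] E)) ∞ (fun x ↦ TotalSpace.mk' (E →L[ℝ] E)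
      (E := fun x : M ↦ TangentSpace 𝓘(ℝ, E) x →L[ℝ] TangentSpace 𝓘(ℝ, E) x) x (J x))
  apply_apply : ∀ (x : M) (v : TangentSpace 𝓘(ℝ, E) x), J x (J x v) = -v
  nijenhuis : ∀ (x : M) (X Y : Π x : M, TangentSpace 𝓘(ℝ, E) x),
    CMDiffAt ∞ (T% X) x → CMDiffAt ∞ (T% Y) x →
      mlieBracket 𝓘(ℝ, E) (fun y ↦ J y (X y)) (fun y ↦ J y (Y y)) x
        - J x (mlieBracket 𝓘(ℝ, E) (fun y ↦ J y (X y)) Y x)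
        - J x (mlieBracket 𝓘(ℝ, E) X (fun y ↦ J y (Y y)) x)
        - mlieBracket 𝓘(ℝ, E) X Y x = 0

/-- The 2-form `α` satisfies `dα = 0` on `U`, with `dα` given by the invariant formula. -/
def IsClosedTwoFormOn (α : Π x : M, TangentSpace 𝓘(ℝ, E) x → TangentSpace 𝓘(ℝ, E) x → ℝ)
    (U : Set M) : Prop :=
  ∀ x ∈ U, ∀ X Y Z : Π x : M, TangentSpace 𝓘(ℝ, E) x,
    CMDiffAt ∞ (T% X) x → CMDiffAt ∞ (T% Y) x → CMDiffAt ∞ (T% Z) x →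
      d% (fun y ↦ α y (Y y) (Z y)) x (X x) - d% (fun y ↦ α y (X y) (Z y)) x (Y x)
        + d% (fun y ↦ α y (X y) (Y y)) x (Z x)
        - α x (mlieBracket 𝓘(ℝ, E) X Y x) (Z x) + α x (mlieBracket 𝓘(ℝ, E) X Z x) (Y x)
        - α x (mlieBracket 𝓘(ℝ, E) Y Z x) (X x) = 0

/-- `h` is, on the open set `U`, a Kähler metric for the complex structure `J`: a smooth Riemannian
metric which is Hermitian and whose fundamental 2-form `h(X, JY)` is closed. -/
structure IsKahlerOn (J : Π x : M, TangentSpace 𝓘(ℝ, E) x →L[ℝ] TangentSpace 𝓘(ℝ, E) x)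
    (h : Π x : M, TangentSpace 𝓘(ℝ, E) x →L[ℝ] TangentSpace 𝓘(ℝ, E) x →L[ℝ] ℝ) (U : Set M) :
    Prop where
  contMDiffOn : ContMDiffOn 𝓘(ℝ, E) (𝓘(ℝ, E).prod 𝓘(ℝ, E →L[ℝ] E →L[ℝ] ℝ)) ∞
    (fun x ↦ TotalSpace.mk' (E →L[ℝ] E →L[ℝ] ℝ)
      (E := fun x : M ↦ TangentSpace 𝓘(ℝ, E) x →L[ℝ] TangentSpace 𝓘(ℝ, E) x →L[ℝ] ℝ) x (h x)) U
  symm : ∀ x ∈ U, ∀ v w : TangentSpace 𝓘(ℝ, E) x, h x v w = h x w v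
  pos : ∀ x ∈ U, ∀ v : TangentSpace 𝓘(ℝ, E) x, v ≠ 0 → 0 < h x v v
  hermitian : ∀ x ∈ U, ∀ v w : TangentSpace 𝓘(ℝ, E) x, h x (J x v) (J x w) = h x v w
  closed : IsClosedTwoFormOn (fun x v w ↦ h x v (J x w)) U

/-- `(M, J, g)`, with `g` the Riemannian metric of `M`, is locally conformal Kähler with Lee form
`θ`: `J` is a complex structure, `g` is Hermitian, and around each point there are an open set `U`
and a smooth `f : U → ℝ` such that `e^{-f} g` is Kähler on `U` and `θ = df` on `U`. -/
structure IsLocallyConformalKahler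
    (J : Π x : M, TangentSpace 𝓘(ℝ, E) x →L[ℝ] TangentSpace 𝓘(ℝ, E) x)
    (θ : Π x : M, TangentSpace 𝓘(ℝ, E) x →L[ℝ] ℝ) : Prop where
  isComplexStructure : IsComplexStructure J
  hermitian : ∀ (x : M) (v w : TangentSpace 𝓘(ℝ, E) x), ⟪J x v, J x w⟫_ℝ = ⟪v, w⟫_ℝ
  locally_kahler : ∀ x : M, ∃ U : Set M, IsOpen U ∧ x ∈ U ∧ ∃ f : M → ℝ,
    CMDiff[U] ∞ f ∧ IsKahlerOn J (fun y ↦ Real.exp (-f y) • metricForm y) U ∧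
      ∀ y ∈ U, θ y = d% f y

/-- `ι : K → M` is a complex (immersed) submanifold of `(M, J)`: a smooth immersion whose tangent
spaces are `J`-invariant. -/
structure IsComplexSubmanifold
    (J : Π x : M, TangentSpace 𝓘(ℝ, E) x →L[ℝ] TangentSpace 𝓘(ℝ, E) x) (ι : K → M) : Prop where
  contMDiff : ContMDiff 𝓘(ℝ, F) 𝓘(ℝ, E) ∞ ι
  injective_mfderiv : ∀ p : K, Function.Injective (mfderiv 𝓘(ℝ, F) 𝓘(ℝ, E) ι p)
  map_mem : ∀ p : K, ∀ u ∈ tangentImage F ι p, J (ι p) u ∈ tangentImage F ι p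

end Sub

end
end LCK

/-! Let Ω = g(·, J·). Closedness of e^{-f}Ω means dΩ = θ ∧ Ω. Evaluating this on X, JX, Z and
comparing with the Koszul formula computes ⟨∇_X X + ∇_{JX} JX + J[X, JX], Z⟩; for Z = ν orthogonal
to X and JX the value is -|X|² θ(ν) (`inner_leviCivita_add`). If X and JX are tangent to K, so is
J[X, JX], hence A(X,X) + A(JX,JX) = -|X|² B^⊥. Since J carries an orthonormal basis of the
2n-dimensional space T_pK to another one, summing over a basis gives 2 trace A = -2n B^⊥, and
V-minimality follows because B^⊥ - B is tangent.

Extending tangent fields off an immersed K is avoided by working at one point in charts. For X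
constant in the chart, with value v, the terms involving J produce (D_{Jv}J)v + J(D_vJ)v
(`inner_leviCivita_extend`). On the side of K, A(v,w) is the normal part of D²ι(v,w) + Γ(v,w)
(`secondFundamentalForm_eq`), where Γ is the Christoffel term. Differentiating the J-invariance of
the tangent spaces (`exists_secondDeriv_add`) in the directions v and Jv gives D²ι(v,v) + D²ι(Jv,Jv)
= (D_{Jv}J)v + J(D_vJ)v modulo tangent vectors, so the two computations match in
`secondFundamentalForm_add_map`.

Smoothness of B is local: in a chart it is the inverse metric applied to df. -/

namespace LCK

noncomputable section

/-! ### Calculus in the preferred chart, and fields constant in it -/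

section Charts
variable {E : Type*} [NormedAddCommGroup E] [NormedSpace ℝ E]
  {M : Type*} [TopologicalSpace M] [ChartedSpace E M]
  {G H : Type*} [NormedAddCommGroup G] [NormedSpace ℝ G] [NormedAddCommGroup H] [NormedSpace ℝ H]

theorem differentiableAt_comp_extChartAt_symm {f : M → G} {x : M} (hf : MDiffAt f x) :
    DifferentiableAt ℝ (f ∘ (extChartAt 𝓘(ℝ, E) x).symm) (extChartAt 𝓘(ℝ, E) x x) := by
  have h := MDifferentiableWithinAt.differentiableWithinAt_comp_extChartAt_symm
    (mdifferentiableWithinAt_univ.2 hf)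
  exact differentiableWithinAt_univ.1 (by simpa using h)

theorem mvfderiv_eq_fderiv {f : M → G} {x : M} (hf : MDiffAt f x) :
    d% f x = fderiv ℝ (f ∘ (extChartAt 𝓘(ℝ, E) x).symm) (extChartAt 𝓘(ℝ, E) x x) := by
  ext v
  simp only [mvfderiv, hf.mfderiv]
  simp [writtenInExtChartAt, fderivWithin_univ]
  rfl

theorem mvfderiv_congr {f g : M → G} {x : M} (h : f =ᶠ[𝓝 x] g) : d% f x = d% g x := by
  have h2 := h.mfderiv_eq (I := 𝓘(ℝ, E)) (I' := 𝓘(ℝ, G))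
  ext v
  simp only [mvfderiv]
  exact congrArg (fun L : E →L[ℝ] G ↦ L v) h2

theorem mvfderiv_clm_apply {g : M → G →L[ℝ] H} {h : M → G} {x : M} (hg : MDiffAt g x)
    (hh : MDiffAt h x) (v : TangentSpace 𝓘(ℝ, E) x) :
    d% (fun y ↦ g y (h y)) x v = (d% g x v) (h x) + g x (d% h x v) := by
  rw [mvfderiv_eq_fderiv hg, mvfderiv_eq_fderiv hh, mvfderiv_eq_fderiv (hg.clm_apply hh)]
  have := fderiv_clm_apply (differentiableAt_comp_extChartAt_symm hg)
    (differentiableAt_comp_extChartAt_symm hh)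
  change (fderiv ℝ (fun y ↦ (g ∘ (extChartAt 𝓘(ℝ, E) x).symm) y
    ((h ∘ (extChartAt 𝓘(ℝ, E) x).symm) y)) (extChartAt 𝓘(ℝ, E) x x)) v = _
  rw [this]
  simp
  exact add_comm _ _

/-- The factor e^{-f} stays in front, so it can be cancelled from the closedness equation; the term
in df is where the Lee form comes from. -/
theorem mvfderiv_exp_neg_mul {f φ : M → ℝ} {x : M} (hf : MDiffAt f x) (hφ : MDiffAt φ x)
    (v : TangentSpace 𝓘(ℝ, E) x) :
    d% (fun y ↦ Real.exp (-f y) * φ y) x v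
      = Real.exp (-f x) * (d% φ x v - φ x * d% f x v) := by
  have hexp : MDiffAt (fun y ↦ Real.exp (-f y)) x :=
    (Real.differentiable_exp.differentiableAt.comp _
      differentiableAt_id.neg : DifferentiableAt ℝ (fun t : ℝ ↦ Real.exp (-t))
        (f x)).comp_mdifferentiableAt hf
  have h1 : d% (fun y ↦ Real.exp (-f y)) x v = -(Real.exp (-f x) * d% f x v) := by
    rw [mvfderiv_eq_fderiv hexp, mvfderiv_eq_fderiv hf]
    have h := ((differentiableAt_comp_extChartAt_symm hf).hasFDerivAt.neg.exp).fderiv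
    refine (congrArg (fun L : E →L[ℝ] ℝ ↦ L v) h).trans ?_
    simp
    rfl
  rw [mvfderiv_fun_mul hexp hφ]
  simp [h1]
  ring

variable [IsManifold 𝓘(ℝ, E) ∞ M]

/-- The tangent space at x is the model space read through the preferred chart at x, so the
trivialization centred at x is the identity on that fibre. -/
theorem symmL_self (x : M) (w : E) :
    (trivializationAt E (TangentSpace 𝓘(ℝ, E) : M → Type _) x).symmL ℝ x w = w := by
  rw [TangentBundle.symmL_trivializationAt (by simp)]
  rw [mfderivWithin_range_extChartAt_symm]
  rfl

theorem continuousLinearMapAt_self (x : M) (w : TangentSpace 𝓘(ℝ, E) x) :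
    (trivializationAt E (TangentSpace 𝓘(ℝ, E) : M → Type _) x).continuousLinearMapAt ℝ x w = w := by
  rw [TangentBundle.continuousLinearMapAt_trivializationAt (by simp), mfderiv_extChartAt_self]
  rfl

theorem trivializationAt_snd_self (x : M) (w : TangentSpace 𝓘(ℝ, E) x) :
    (trivializationAt E (TangentSpace 𝓘(ℝ, E) : M → Type _) x ⟨x, w⟩).2 = w := by
  rw [← Trivialization.continuousLinearMapAt_apply_of_mem (R := ℝ)]
  · exact continuousLinearMapAt_self x w
  · exact mem_baseSet_trivializationAt' x

theorem extend_apply_eq_symmL {x : M} (w : TangentSpace 𝓘(ℝ, E) x) {y : M}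
    (hy : y ∈ (trivializationAt E (TangentSpace 𝓘(ℝ, E) : M → Type _) x).baseSet) :
    extend E w y
      = (trivializationAt E (TangentSpace 𝓘(ℝ, E) : M → Type _) x).symmL ℝ y w := by
  rw [extend, trivializationAt_snd_self]
  exact (Trivialization.symmL_apply (R := ℝ) _ hy w).symm

/-- Two vector fields which are constant in the same chart commute at its centre. -/
theorem mlieBracket_extend [CompleteSpace E] {x : M} (v w : TangentSpace 𝓘(ℝ, E) x) :
    mlieBracket 𝓘(ℝ, E) (extend E v) (extend E w) x = 0 := by
  have key (u : TangentSpace 𝓘(ℝ, E) x) :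
      mpullbackWithin 𝓘(ℝ, E) 𝓘(ℝ, E) (extChartAt 𝓘(ℝ, E) x).symm (extend E u)
        (Set.range 𝓘(ℝ, E)) =ᶠ[𝓝 (extChartAt 𝓘(ℝ, E) x x)] fun _ ↦ (u : E) := by
    filter_upwards [extChartAt_target_mem_nhds (I := 𝓘(ℝ, E)) x] with z hz
    have hy : (extChartAt 𝓘(ℝ, E) x).symm z ∈ (chartAt E x).source := by
      simpa using (extChartAt 𝓘(ℝ, E) x).map_target hz
    rw [mpullbackWithin_apply, extend_apply_eq_symmL _ (by simpa using hy), TangentBundle.symmL_trivializationAt hy,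
      (extChartAt 𝓘(ℝ, E) x).right_inv hz]
    exact (isInvertible_mfderivWithin_extChartAt_symm hz).inverse_apply_self u
  rw [mlieBracket, mlieBracketWithin_apply,
    Filter.EventuallyEq.lieBracketWithin_vectorField_eq_of_mem
      (nhdsWithin_le_nhds (key v)) (nhdsWithin_le_nhds (key w)) (by simp)]
  have h0 (a b : E) (s : Set E) (z : E) :
      lieBracketWithin ℝ (fun _ : E ↦ a) (fun _ ↦ b) s z = 0 := by
    simp [lieBracketWithin]
  exact (congrArg _ (h0 v w _ _)).trans (map_zero _)

/-- A vector of the model space, as a tangent vector at `x`. -/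
def tangentOf (x : M) (w : E) : TangentSpace 𝓘(ℝ, E) x := w

theorem eventually_eq_sum_extend {ι : Type*} [Fintype ι] (b : Module.Basis ι ℝ E)
    (Y : Π x : M, TangentSpace 𝓘(ℝ, E) x) (x : M) :
    ∀ᶠ y in 𝓝 x, Y y = ∑ i, b.repr
      (trivializationAt E (TangentSpace 𝓘(ℝ, E) : M → Type _) x ⟨y, Y y⟩).2 i •
        extend E (tangentOf x (b i)) y := by
  have hx := mem_baseSet_trivializationAt' (F := E) (E := (TangentSpace 𝓘(ℝ, E) : M → Type _)) x
  filter_upwards [(trivializationAt E (TangentSpace 𝓘(ℝ, E) : M → Type _) x).open_baseSet.mem_nhds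
    hx] with y hy
  have h := congrArg ((trivializationAt E (TangentSpace 𝓘(ℝ, E) : M → Type _) x).symmL ℝ y)
    (b.sum_repr (trivializationAt E (TangentSpace 𝓘(ℝ, E) : M → Type _) x ⟨y, Y y⟩).2)
  rw [map_sum, ← Trivialization.continuousLinearMapAt_apply_of_mem (R := ℝ) _ hy,
    Trivialization.symmL_continuousLinearMapAt _ hy] at h
  rw [← Trivialization.continuousLinearMapAt_apply_of_mem (R := ℝ) _ hy]
  refine h.symm.trans (Finset.sum_congr rfl fun i _ ↦ ?_)
  rw [map_smul]
  exact congrArg _ (extend_apply_eq_symmL (tangentOf x (b i)) hy).symm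

theorem mdifferentiableAt_trivializationAt_snd {Y : Π x : M, TangentSpace 𝓘(ℝ, E) x} {x : M}
    (hY : MDiffAt (T% Y) x) :
    MDiffAt (fun y ↦ (trivializationAt E (TangentSpace 𝓘(ℝ, E) : M → Type _) x ⟨y, Y y⟩).2) x :=
  (mdifferentiableAt_section _ _).1 hY

theorem mvfderiv_trivializationAt_extend {x : M} (w : TangentSpace 𝓘(ℝ, E) x) :
    d% (fun y ↦
      (trivializationAt E (TangentSpace 𝓘(ℝ, E) : M → Type _) x ⟨y, extend E w y⟩).2) x = 0 := by
  obtain ⟨c, hc⟩ : ∃ c : E, ∀ᶠ y in 𝓝 x,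
      (trivializationAt E (TangentSpace 𝓘(ℝ, E) : M → Type _) x ⟨y, extend E w y⟩).2 = c := by
    refine ⟨w, ?_⟩
    have hx := mem_baseSet_trivializationAt' (F := E) (E := (TangentSpace 𝓘(ℝ, E) : M → Type _)) x
    filter_upwards
      [(trivializationAt E (TangentSpace 𝓘(ℝ, E) : M → Type _) x).open_baseSet.mem_nhds hx] with y hy
    rw [← Trivialization.continuousLinearMapAt_apply_of_mem (R := ℝ) _ hy,
      extend_apply_eq_symmL _ hy]
    exact Trivialization.continuousLinearMapAt_symmL _ hy _
  rw [mvfderiv_congr hc, mvfderiv_const]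

end Charts

/-! ### The Levi-Civita connection in coordinates -/

section LeviCivita
variable {E : Type*} [NormedAddCommGroup E] [NormedSpace ℝ E] [FiniteDimensional ℝ E]
  {M : Type*} [TopologicalSpace M] [ChartedSpace E M] [IsManifold 𝓘(ℝ, E) ∞ M]
  [RiemannianBundle (fun x : M ↦ TangentSpace 𝓘(ℝ, E) x)]
  [IsContMDiffRiemannianBundle 𝓘(ℝ, E) ∞ E (fun x : M ↦ TangentSpace 𝓘(ℝ, E) x)]

theorem leviCivita_sub_apply_eq_mlieBracket {X Y : Π x : M, TangentSpace 𝓘(ℝ, E) x} {x : M}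
    (hX : MDiffAt (T% X) x) (hY : MDiffAt (T% Y) x) :
    leviCivita Y x (X x) - leviCivita X x (Y x) = mlieBracket 𝓘(ℝ, E) X Y x := by
  have : CompleteSpace E := FiniteDimensional.complete ℝ E
  exact (CovariantDerivative.torsion_eq_zero_iff _).1 (leviCivita_torsion (E := E) (M := M)) hX hY

/-- Symmetry of the Christoffel symbols: the torsion vanishes and fields constant in one chart
commute at its centre. -/
theorem leviCivita_extend_comm {x : M} (v w : TangentSpace 𝓘(ℝ, E) x) :
    leviCivita (extend E v) x w = leviCivita (extend E w) x v := by
  have : CompleteSpace E := FiniteDimensional.complete ℝ E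
  have h := leviCivita_sub_apply_eq_mlieBracket
    (mdifferentiableAt_extend 𝓘(ℝ, E) E v) (mdifferentiableAt_extend 𝓘(ℝ, E) E w)
  rw [mlieBracket_extend, sub_eq_zero] at h
  simpa using h.symm

theorem leviCivita_sum_smul {ι : Type*} (s : Finset ι) {f : ι → M → ℝ}
    {σ : ι → Π x : M, TangentSpace 𝓘(ℝ, E) x} {x : M} (hf : ∀ i, MDiffAt (f i) x)
    (hσ : ∀ i, MDiffAt (T% (σ i)) x) (v : TangentSpace 𝓘(ℝ, E) x) :
    MDiffAt (T% (fun y ↦ ∑ i ∈ s, f i y • σ i y)) x ∧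
    leviCivita (fun y ↦ ∑ i ∈ s, f i y • σ i y) x v
      = ∑ i ∈ s, (f i x • leviCivita (σ i) x v + (d% (f i) x v) • σ i x) := by
  classical
  refine ⟨MDifferentiableAt.sum_section fun i _ ↦ (hf i).smul_section (hσ i), ?_⟩
  induction s using Finset.induction_on with
  | empty =>
    simp only [Finset.sum_empty]
    have h := CovariantDerivative.zero (leviCivita (E := E) (M := M))
    exact congrArg (fun c ↦ c x v) h
  | insert a s ha ih =>
    simp only [Finset.sum_insert ha]
    have h1 := (hf a).smul_section (hσ a)
    have h2 : MDiffAt (T% (fun y ↦ ∑ i ∈ s, f i y • σ i y)) x :=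
      MDifferentiableAt.sum_section fun i _ ↦ (hf i).smul_section (hσ i)
    have h3 := leviCivita.isCovariantDerivativeOnUniv.add h1 h2
    have h4 := leviCivita.isCovariantDerivativeOnUniv.leibniz (hσ a) (hf a)
    rw [← ih]
    have h5 := congrArg (fun c ↦ c v) h3
    have h6 := congrArg (fun c ↦ c v) h4
    simp only [_root_.add_apply, _root_.smul_apply, ContinuousLinearMap.smulRight_apply] at h5 h6
    rw [← h6]
    exact h5

/-- Near x the field is a finite combination of frame fields, so locality and the Leibniz rule
apply; the derivatives of the coefficients reassemble into the derivative of the coordinate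
expression. -/
theorem leviCivita_eq_sum_repr {ι : Type*} [Fintype ι] (b : Module.Basis ι ℝ E)
    {Y : Π x : M, TangentSpace 𝓘(ℝ, E) x} {x : M}
    (hY : MDiffAt (T% Y) x) (v : TangentSpace 𝓘(ℝ, E) x) :
    leviCivita Y x v = ∑ i, b.repr (Y x) i • leviCivita (extend E (tangentOf x (b i))) x v +
      (trivializationAt E (TangentSpace 𝓘(ℝ, E) : M → Type _) x).symmL ℝ x
        (d% (fun y ↦
          (trivializationAt E (TangentSpace 𝓘(ℝ, E) : M → Type _) x ⟨y, Y y⟩).2) x v) := by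
  have hrep := mdifferentiableAt_trivializationAt_snd hY
  let L (i : ι) : E →L[ℝ] ℝ := (b.coord i).toContinuousLinearMap
  have hL (i : ι) : MDiffAt (fun y ↦ L i
      (trivializationAt E (TangentSpace 𝓘(ℝ, E) : M → Type _) x ⟨y, Y y⟩).2) x :=
    mdifferentiableAt_const.clm_apply hrep
  have hσ (i : ι) : MDiffAt (T% (extend E (tangentOf x (b i)))) x :=
    mdifferentiableAt_extend 𝓘(ℝ, E) E _
  have hsum := leviCivita_sum_smul Finset.univ hL hσ v
  have h1 := leviCivita.isCovariantDerivativeOnUniv.congr_of_eventuallyEq hY hsum.1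
    Filter.univ_mem (eventually_eq_sum_extend b Y x)
  rw [h1, hsum.2, Finset.sum_add_distrib]
  congr 1
  · refine Finset.sum_congr rfl fun i _ ↦ ?_
    rw [trivializationAt_snd_self]
    rfl
  · rw [← b.sum_repr (d% (fun y ↦
          (trivializationAt E (TangentSpace 𝓘(ℝ, E) : M → Type _) x ⟨y, Y y⟩).2) x v), map_sum]
    refine Finset.sum_congr rfl fun i _ ↦ ?_
    rw [mvfderiv_clm_apply mdifferentiableAt_const hrep, mvfderiv_const, map_smul,
      extend_apply_self, symmL_self]
    simp only [L, LinearMap.coe_toContinuousLinearMap', Module.Basis.coord_apply,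
      _root_.zero_apply, zero_add]
    rfl

/-- The Levi-Civita connection in the chart at `x`. -/
theorem leviCivita_eq_mvfderiv_add {Y : Π x : M, TangentSpace 𝓘(ℝ, E) x} {x : M}
    (hY : MDiffAt (T% Y) x) (v : TangentSpace 𝓘(ℝ, E) x) :
    leviCivita Y x v = (trivializationAt E (TangentSpace 𝓘(ℝ, E) : M → Type _) x).symmL ℝ x
        (d% (fun y ↦
          (trivializationAt E (TangentSpace 𝓘(ℝ, E) : M → Type _) x ⟨y, Y y⟩).2) x v)
      + leviCivita (extend E (Y x)) x v := by
  rw [leviCivita_eq_sum_repr (Module.finBasis ℝ E) hY,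
    leviCivita_eq_sum_repr (Module.finBasis ℝ E) (mdifferentiableAt_extend 𝓘(ℝ, E) E (Y x)),
    mvfderiv_trivializationAt_extend, extend_apply_self, add_comm]
  simp

end LeviCivita

/-! ### The locally conformal Kähler condition and the Koszul formula -/

section Hermitian
variable {E : Type*} [NormedAddCommGroup E] [NormedSpace ℝ E] [FiniteDimensional ℝ E]
  {M : Type*} [TopologicalSpace M] [ChartedSpace E M] [IsManifold 𝓘(ℝ, E) ∞ M]
  [RiemannianBundle (fun x : M ↦ TangentSpace 𝓘(ℝ, E) x)]
  [IsContMDiffRiemannianBundle 𝓘(ℝ, E) ∞ E (fun x : M ↦ TangentSpace 𝓘(ℝ, E) x)]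
  {J : Π x : M, TangentSpace 𝓘(ℝ, E) x →L[ℝ] TangentSpace 𝓘(ℝ, E) x}
  {θ : Π x : M, TangentSpace 𝓘(ℝ, E) x →L[ℝ] ℝ}

theorem inner_leviCivita_self {X Z : Π x : M, TangentSpace 𝓘(ℝ, E) x} {x : M}
    (hX : MDiffAt (T% X) x) (hZ : MDiffAt (T% Z) x) :
    ⟪leviCivita X x (X x), Z x⟫_ℝ = d% (fun y ↦ ⟪X y, Z y⟫_ℝ) x (X x)
      - (1 / 2 : ℝ) * d% (fun y ↦ ⟪X y, X y⟫_ℝ) x (Z x)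
      - ⟪mlieBracket 𝓘(ℝ, E) X Z x, X x⟫_ℝ := by
  refine (inner_leviCivitaFun hX hX hZ).trans ?_
  rw [koszul]
  simp only [mlieBracket_self, Pi.zero_apply, inner_zero_left]
  ring

theorem IsLocallyConformalKahler.inner_map_left (hM : IsLocallyConformalKahler J θ) (x : M)
    (v w : TangentSpace 𝓘(ℝ, E) x) : ⟪J x v, w⟫_ℝ = -⟪v, J x w⟫_ℝ := by
  rw [← hM.hermitian x v (J x w), hM.isComplexStructure.apply_apply, inner_neg_right, neg_neg]

/-- The equation `dΩ = θ ∧ Ω`, evaluated on `X`, `JX`, `Z`. -/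
theorem IsLocallyConformalKahler.inner_leviCivita_add (hM : IsLocallyConformalKahler J θ)
    {X Z : Π x : M, TangentSpace 𝓘(ℝ, E) x} {x : M}
    (hX : CMDiffAt ∞ (T% X) x) (hZ : CMDiffAt ∞ (T% Z) x) :
    ⟪leviCivita X x (X x) + leviCivita (fun y ↦ J y (X y)) x (J x (X x))
      + J x (mlieBracket 𝓘(ℝ, E) X (fun y ↦ J y (X y)) x), Z x⟫_ℝ
      = θ x (X x) * ⟪X x, Z x⟫_ℝ + θ x (J x (X x)) * ⟪J x (X x), Z x⟫_ℝ
        - θ x (Z x) * ⟪X x, X x⟫_ℝ := by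
  obtain ⟨U, hUo, hxU, f, hf, hk, hθ⟩ := hM.locally_kahler x
  have hJX : CMDiffAt ∞ (T% (fun y ↦ J y (X y))) x :=
    ContMDiffAt.clm_bundle_apply (hM.isComplexStructure.contMDiff x) hX
  have dX := hX.mdifferentiableAt (by simp)
  have dJX := hJX.mdifferentiableAt (by simp)
  have dZ := hZ.mdifferentiableAt (by simp)
  have df : MDiffAt f x := ((hf x hxU).contMDiffAt (hUo.mem_nhds hxU)).mdifferentiableAt (by simp)
  -- All six terms of this identity reduce to the metric by J² = -1 and the skewness of J. They
  -- match the sum of the Koszul formulas for X and JX: the two halves of Z|X|² and Z|JX|² add up,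
  -- and the bracket [X, JX] yields the J[X, JX] term.
  have hc := hk.closed x hxU X (fun y ↦ J y (X y)) Z hX hJX hZ
  have e1 : (fun y ↦ (Real.exp (-f y) • metricForm y) (J y (X y)) (J y (Z y)))
      = fun y ↦ Real.exp (-f y) * ⟪X y, Z y⟫_ℝ := by
    funext y
    exact congrArg _ (hM.hermitian y _ _)
  have e2 : (fun y ↦ (Real.exp (-f y) • metricForm y) (X y) (J y (Z y)))
      = fun y ↦ Real.exp (-f y) * (-⟪J y (X y), Z y⟫_ℝ) := by
    funext y
    rw [hM.inner_map_left, neg_neg]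
    rfl
  have e3 : (fun y ↦ (Real.exp (-f y) • metricForm y) (X y) (J y (J y (X y))))
      = fun y ↦ Real.exp (-f y) * (-⟪X y, X y⟫_ℝ) := by
    funext y
    rw [hM.isComplexStructure.apply_apply, ← inner_neg_right]
    rfl
  have e4 : (fun y ↦ ⟪J y (X y), J y (X y)⟫_ℝ) = fun y ↦ ⟪X y, X y⟫_ℝ := by
    funext y
    exact hM.hermitian y _ _
  rw [e1, e2, e3, mvfderiv_exp_neg_mul df (mdiffAt_inner dX dZ),
    mvfderiv_exp_neg_mul (φ := fun y ↦ -⟪J y (X y), Z y⟫_ℝ) df (mdiffAt_inner dJX dZ).neg,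
    mvfderiv_exp_neg_mul (φ := fun y ↦ -⟪X y, X y⟫_ℝ) df (mdiffAt_inner dX dX).neg, ← hθ x hxU] at hc
  rw [inner_add_left, inner_add_left, inner_leviCivita_self dX dZ,
    inner_leviCivita_self (X := fun y ↦ J y (X y)) dJX dZ, e4, hM.inner_map_left]
  have hexp := Real.exp_ne_zero (-f x)
  have e5 (u w : TangentSpace 𝓘(ℝ, E) x) :
    (Real.exp (-f x) • metricForm x) u w = Real.exp (-f x) * ⟪u, w⟫_ℝ := rfl
  have e6 (φ : M → ℝ) (v : TangentSpace 𝓘(ℝ, E) x) :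
      d% (fun y ↦ - φ y) x v = - d% φ x v := by
    have := mvfderiv_neg (I := 𝓘(ℝ, E)) (g := φ) (x := x)
    exact congrArg (fun L ↦ L v) this
  simp only [e5, e6, hM.isComplexStructure.apply_apply, inner_neg_right] at hc ⊢
  apply mul_left_cancel₀ hexp
  linear_combination hc

end Hermitian

/-! ### Endomorphism fields in coordinates -/

section Endomorphism
variable {E : Type*} [NormedAddCommGroup E] [NormedSpace ℝ E]
  {M : Type*} [TopologicalSpace M] [ChartedSpace E M] [IsManifold 𝓘(ℝ, E) ∞ M]

/-- An endomorphism field in the chart at `x`. -/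
def endoInChart (J : Π x : M, TangentSpace 𝓘(ℝ, E) x →L[ℝ] TangentSpace 𝓘(ℝ, E) x) (x y : M) :
    E →L[ℝ] E :=
  ContinuousLinearMap.inCoordinates E (TangentSpace 𝓘(ℝ, E) : M → Type _) E
    (TangentSpace 𝓘(ℝ, E) : M → Type _) x y x y (J y)

/-- The derivative at `x` of an endomorphism field, read in the chart at `x`. -/
def endoDeriv (J : Π x : M, TangentSpace 𝓘(ℝ, E) x →L[ℝ] TangentSpace 𝓘(ℝ, E) x) (x : M)
    (v w : TangentSpace 𝓘(ℝ, E) x) : TangentSpace 𝓘(ℝ, E) x :=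
  (trivializationAt E (TangentSpace 𝓘(ℝ, E) : M → Type _) x).symmL ℝ x
    (d% (endoInChart J x) x v w)

variable {J : Π x : M, TangentSpace 𝓘(ℝ, E) x →L[ℝ] TangentSpace 𝓘(ℝ, E) x}

theorem IsComplexStructure.mdifferentiableAt_endoInChart
    (hJ : IsComplexStructure J) (x : M) : MDiffAt (endoInChart J x) x :=
  ((contMDiffAt_hom_bundle _).1 (hJ.contMDiff x)).2.mdifferentiableAt (by simp)

theorem endoInChart_self (x : M) (w : TangentSpace 𝓘(ℝ, E) x) :
    endoInChart J x x w = J x w := by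
  refine (continuousLinearMapAt_self (E := E) x _).trans ?_
  exact congrArg (J x) (symmL_self (E := E) x w)

theorem continuousLinearMapAt_endo {x y : M}
    (hy : y ∈ (trivializationAt E (TangentSpace 𝓘(ℝ, E) : M → Type _) x).baseSet)
    (w : TangentSpace 𝓘(ℝ, E) y) :
    (trivializationAt E (TangentSpace 𝓘(ℝ, E) : M → Type _) x).continuousLinearMapAt ℝ y (J y w)
      = endoInChart J x y ((trivializationAt E (TangentSpace 𝓘(ℝ, E) : M → Type _)
          x).continuousLinearMapAt ℝ y w) := by
  simp only [endoInChart, ContinuousLinearMap.inCoordinates, ContinuousLinearMap.comp_apply]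
  rw [Trivialization.symmL_continuousLinearMapAt _ hy]

end Endomorphism

/-! ### The structure equation for fields constant in a chart -/

section Ambient
variable {E : Type*} [NormedAddCommGroup E] [NormedSpace ℝ E] [FiniteDimensional ℝ E]
  {M : Type*} [TopologicalSpace M] [ChartedSpace E M] [IsManifold 𝓘(ℝ, E) ∞ M]
  [RiemannianBundle (fun x : M ↦ TangentSpace 𝓘(ℝ, E) x)]
  [IsContMDiffRiemannianBundle 𝓘(ℝ, E) ∞ E (fun x : M ↦ TangentSpace 𝓘(ℝ, E) x)]
  {J : Π x : M, TangentSpace 𝓘(ℝ, E) x →L[ℝ] TangentSpace 𝓘(ℝ, E) x}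
  {θ : Π x : M, TangentSpace 𝓘(ℝ, E) x →L[ℝ] ℝ}

theorem contMDiffAt_map_extend (hJ : IsComplexStructure J) {x : M}
    (w : TangentSpace 𝓘(ℝ, E) x) : CMDiffAt ∞ (T% (fun y ↦ J y (extend E w y))) x :=
  ContMDiffAt.clm_bundle_apply (hJ.contMDiff x) (contMDiffAt_extend 𝓘(ℝ, E) E w)

/-- In the chart the field is y ↦ J(y)w with w constant, so only J is differentiated, and the
Christoffel term is taken at Jw. -/
theorem leviCivita_map_extend (hJ : IsComplexStructure J) {x : M}
    (v w : TangentSpace 𝓘(ℝ, E) x) :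
    leviCivita (fun y ↦ J y (extend E w y)) x v
      = endoDeriv J x v w + leviCivita (extend E (J x w)) x v := by
  have : CompleteSpace E := FiniteDimensional.complete ℝ E
  have hx := mem_baseSet_trivializationAt' (F := E) (E := (TangentSpace 𝓘(ℝ, E) : M → Type _)) x
  have hbase := (trivializationAt E (TangentSpace 𝓘(ℝ, E) : M → Type _) x).open_baseSet.mem_nhds hx
  have hext := mdifferentiableAt_trivializationAt_snd (mdifferentiableAt_extend 𝓘(ℝ, E) E w)
  rw [leviCivita_eq_mvfderiv_add ((contMDiffAt_map_extend hJ w).mdifferentiableAt (by simp)),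
    extend_apply_self, endoDeriv]
  congr 2
  have hev : (fun y ↦ (trivializationAt E (TangentSpace 𝓘(ℝ, E) : M → Type _) x
        ⟨y, J y (extend E w y)⟩).2) =ᶠ[𝓝 x] fun y ↦ endoInChart J x y
      (trivializationAt E (TangentSpace 𝓘(ℝ, E) : M → Type _) x ⟨y, extend E w y⟩).2 := by
    filter_upwards [hbase] with y hy
    rw [← Trivialization.continuousLinearMapAt_apply_of_mem (R := ℝ) _ hy,
      ← Trivialization.continuousLinearMapAt_apply_of_mem (R := ℝ) _ hy,
      continuousLinearMapAt_endo hy]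
  rw [mvfderiv_congr hev, mvfderiv_clm_apply (hJ.mdifferentiableAt_endoInChart x) hext,
    mvfderiv_trivializationAt_extend, trivializationAt_snd_self, extend_apply_self]
  simp

/-- The bracket is ∇_X(JX) - ∇_{JX}X, and the two Christoffel terms cancel by symmetry. -/
theorem mlieBracket_extend_map_extend (hJ : IsComplexStructure J) {x : M}
    (v : TangentSpace 𝓘(ℝ, E) x) :
    mlieBracket 𝓘(ℝ, E) (extend E v) (fun y ↦ J y (extend E v y)) x = endoDeriv J x v v := by
  rw [← leviCivita_sub_apply_eq_mlieBracket (mdifferentiableAt_extend 𝓘(ℝ, E) E v)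
    ((contMDiffAt_map_extend hJ v).mdifferentiableAt (by simp)), extend_apply_self,
    leviCivita_map_extend hJ, leviCivita_extend_comm v, add_sub_cancel_right]

/-- The equation `dΩ = θ ∧ Ω` at a point, read in a chart. -/
theorem IsLocallyConformalKahler.inner_leviCivita_extend (hM : IsLocallyConformalKahler J θ)
    {x : M} {v ν : TangentSpace 𝓘(ℝ, E) x} (hv : ⟪v, ν⟫_ℝ = 0) (hJv : ⟪J x v, ν⟫_ℝ = 0) :
    ⟪leviCivita (extend E v) x v + leviCivita (extend E (J x v)) x (J x v)
      + endoDeriv J x (J x v) v + J x (endoDeriv J x v v), ν⟫_ℝ = - (⟪v, v⟫_ℝ * θ x ν) := by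
  have h := hM.inner_leviCivita_add (contMDiffAt_extend 𝓘(ℝ, E) E v)
    (contMDiffAt_extend 𝓘(ℝ, E) E ν)
  rw [mlieBracket_extend_map_extend hM.isComplexStructure] at h
  simp only [extend_apply_self, hv, hJv] at h
  rw [leviCivita_map_extend hM.isComplexStructure] at h
  simp only [inner_add_left] at h ⊢
  linarith

end Ambient

/-! ### First and second derivatives of the immersion in coordinates -/

section Immersion
variable {E : Type*} [NormedAddCommGroup E] [NormedSpace ℝ E]
  {M : Type*} [TopologicalSpace M] [ChartedSpace E M] [IsManifold 𝓘(ℝ, E) ∞ M]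
  {F : Type*} [NormedAddCommGroup F] [NormedSpace ℝ F]
  {K : Type*} [TopologicalSpace K] [ChartedSpace F K] [IsManifold 𝓘(ℝ, F) ∞ K]

/-- The differential of `ι` near `p`, read in the charts at `p` and `ι p`. -/
def mfderivInChart (ι : K → M) (p : K) : K → F →L[ℝ] E :=
  inTangentCoordinates 𝓘(ℝ, F) 𝓘(ℝ, E) id ι (mfderiv 𝓘(ℝ, F) 𝓘(ℝ, E) ι) p

/-- The second derivative of `ι` at `p`, read in the charts at `p` and `ι p`. -/
def secondDeriv (ι : K → M) (p : K) (v w : TangentSpace 𝓘(ℝ, F) p) :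
    TangentSpace 𝓘(ℝ, E) (ι p) :=
  (trivializationAt E (TangentSpace 𝓘(ℝ, E) : M → Type _) (ι p)).symmL ℝ (ι p)
    (d% (mfderivInChart (E := E) (F := F) ι p) p v w)

variable {ι : K → M}

theorem mdifferentiableAt_mfderivInChart (hι : ContMDiff 𝓘(ℝ, F) 𝓘(ℝ, E) ∞ ι) (p : K) :
    MDiffAt (mfderivInChart (E := E) (F := F) ι p) p :=
  ((hι p).mfderiv_const (m := 1) (by norm_cast)).mdifferentiableAt (by simp)

theorem mfderivInChart_self (p : K) (w : TangentSpace 𝓘(ℝ, F) p) :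
    mfderivInChart (E := E) (F := F) ι p p w = mfderiv 𝓘(ℝ, F) 𝓘(ℝ, E) ι p w := by
  refine (continuousLinearMapAt_self (E := E) (ι p) _).trans ?_
  exact congrArg (mfderiv 𝓘(ℝ, F) 𝓘(ℝ, E) ι p) (symmL_self (E := F) p w)

theorem continuousLinearMapAt_mfderiv {p q : K}
    (hq : q ∈ (trivializationAt F (TangentSpace 𝓘(ℝ, F) : K → Type _) p).baseSet)
    (w : TangentSpace 𝓘(ℝ, F) q) :
    (trivializationAt E (TangentSpace 𝓘(ℝ, E) : M → Type _) (ι p)).continuousLinearMapAt ℝ (ι q)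
        (mfderiv 𝓘(ℝ, F) 𝓘(ℝ, E) ι q w)
      = mfderivInChart (E := E) (F := F) ι p q ((trivializationAt F (TangentSpace 𝓘(ℝ, F) : K → Type _)
          p).continuousLinearMapAt ℝ q w) := by
  simp only [mfderivInChart, inTangentCoordinates, ContinuousLinearMap.inCoordinates,
    ContinuousLinearMap.comp_apply, id]
  rw [Trivialization.symmL_continuousLinearMapAt _ hq]

theorem eventually_mem_baseSet (hι : ContMDiff 𝓘(ℝ, F) 𝓘(ℝ, E) ∞ ι) (p : K) :
    ∀ᶠ q in 𝓝 p, q ∈ (trivializationAt F (TangentSpace 𝓘(ℝ, F) : K → Type _) p).baseSet ∧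
      ι q ∈ (trivializationAt E (TangentSpace 𝓘(ℝ, E) : M → Type _) (ι p)).baseSet :=
  Filter.Eventually.and ((trivializationAt F (TangentSpace 𝓘(ℝ, F) : K → Type _)
      p).open_baseSet.mem_nhds (mem_baseSet_trivializationAt' p))
    (hι.continuous.continuousAt.eventually
      ((trivializationAt E (TangentSpace 𝓘(ℝ, E) : M → Type _) (ι p)).open_baseSet.mem_nhds
        (mem_baseSet_trivializationAt' (ι p))))

/-- Near p the differential read in charts is the Fréchet derivative of the coordinate expression of
ι, so this is the symmetry of second derivatives of a smooth map. -/
theorem secondDeriv_comm (hι : ContMDiff 𝓘(ℝ, F) 𝓘(ℝ, E) ∞ ι) (p : K)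
    (v w : TangentSpace 𝓘(ℝ, F) p) : secondDeriv (E := E) (F := F) ι p v w = secondDeriv (E := E) (F := F) ι p w v := by
  have hw : ContDiffAt ℝ ∞ (writtenInExtChartAt 𝓘(ℝ, F) 𝓘(ℝ, E) p ι)
      (extChartAt 𝓘(ℝ, F) p p) := by
    have h := (contMDiffAt_iff.1 (hι p)).2
    exact contDiffWithinAt_univ.1 (by simpa using h)
  have hev : (mfderivInChart (E := E) (F := F) ι p) ∘ (extChartAt 𝓘(ℝ, F) p).symm
      =ᶠ[𝓝 (extChartAt 𝓘(ℝ, F) p p)]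
      fderiv ℝ (writtenInExtChartAt 𝓘(ℝ, F) 𝓘(ℝ, E) p ι) := by
    have hz := extChartAt_target_mem_nhds (I := 𝓘(ℝ, F)) p
    have hcont : ContinuousAt (extChartAt 𝓘(ℝ, F) p).symm (extChartAt 𝓘(ℝ, F) p p) :=
      continuousAt_extChartAt_symm p
    have hq := hcont.eventually (by
      rw [extChartAt_to_inv]
      exact hι.continuous.continuousAt.eventually
        ((chartAt E (ι p)).open_source.mem_nhds (mem_chart_source E (ι p))))
    filter_upwards [hz, hq] with z hz hq
    have hp : (extChartAt 𝓘(ℝ, F) p).symm z ∈ (chartAt F p).source := by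
      simpa using (extChartAt 𝓘(ℝ, F) p).map_target hz
    have h1 : MDifferentiableAt 𝓘(ℝ, F) 𝓘(ℝ, F) (extChartAt 𝓘(ℝ, F) p).symm z :=
      mdifferentiableWithinAt_univ.1 (by
        simpa using mdifferentiableWithinAt_extChartAt_symm (I := 𝓘(ℝ, F)) hz)
    have h2 : MDifferentiableAt 𝓘(ℝ, F) 𝓘(ℝ, E) ι ((extChartAt 𝓘(ℝ, F) p).symm z) :=
      (hι _).mdifferentiableAt (by simp)
    have h3 : MDifferentiableAt 𝓘(ℝ, E) 𝓘(ℝ, E) (extChartAt 𝓘(ℝ, E) (ι p))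
      (ι ((extChartAt 𝓘(ℝ, F) p).symm z)) := mdifferentiableAt_extChartAt hq
    have h : HasMFDerivAt 𝓘(ℝ, F) 𝓘(ℝ, E) (writtenInExtChartAt 𝓘(ℝ, F) 𝓘(ℝ, E) p ι) z _ :=
      h3.hasMFDerivAt.comp z (h2.hasMFDerivAt.comp z h1.hasMFDerivAt)
    rw [← _root_.mfderiv_eq_fderiv, h.mfderiv]
    refine (inTangentCoordinates_eq_mfderiv_comp (f := id) hp hq).trans ?_
    -- The two base points φ(φ⁻¹ z) and z are equal but not syntactically so; viewing the
    -- derivatives as maps of F allows the substitution.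
    have key {a b : F} (hab : a = b) :
        (mfderiv[Set.range 𝓘(ℝ, F)] (extChartAt 𝓘(ℝ, F) p).symm a : F →L[ℝ] F)
          = mfderiv 𝓘(ℝ, F) 𝓘(ℝ, F) (extChartAt 𝓘(ℝ, F) p).symm b := by
      subst hab
      simp only [modelWithCornersSelf_coe, Set.range_id, mfderivWithin_univ]
    exact congrArg (fun L : F →L[ℝ] F ↦
      (mfderiv 𝓘(ℝ, E) 𝓘(ℝ, E) (extChartAt 𝓘(ℝ, E) (ι p))
        (ι ((extChartAt 𝓘(ℝ, F) p).symm z)) : E →L[ℝ] E) ∘L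
      ((mfderiv 𝓘(ℝ, F) 𝓘(ℝ, E) ι ((extChartAt 𝓘(ℝ, F) p).symm z) : F →L[ℝ] E) ∘L L))
      (key ((extChartAt 𝓘(ℝ, F) p).right_inv hz))
  have hs : IsSymmSndFDerivAt ℝ (writtenInExtChartAt 𝓘(ℝ, F) 𝓘(ℝ, E) p ι)
      (extChartAt 𝓘(ℝ, F) p p) := hw.isSymmSndFDerivAt (by simp; norm_cast)
  rw [secondDeriv, secondDeriv, mvfderiv_eq_fderiv (mdifferentiableAt_mfderivInChart hι p),
    hev.fderiv_eq]
  exact congrArg _ (hs v w)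

end Immersion

/-! ### The derivative of J-invariance along K -/

section Tangency
variable {E : Type*} [NormedAddCommGroup E] [NormedSpace ℝ E] [FiniteDimensional ℝ E]
  {M : Type*} [TopologicalSpace M] [ChartedSpace E M] [IsManifold 𝓘(ℝ, E) ∞ M]
  {F : Type*} [NormedAddCommGroup F] [NormedSpace ℝ F] [FiniteDimensional ℝ F]
  {K : Type*} [TopologicalSpace K] [ChartedSpace F K] [IsManifold 𝓘(ℝ, F) ∞ K]
  {J : Π x : M, TangentSpace 𝓘(ℝ, E) x →L[ℝ] TangentSpace 𝓘(ℝ, E) x} {ι : K → M}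

theorem IsComplexSubmanifold.eventually_exists_mfderivInChart (hK : IsComplexSubmanifold F J ι)
    (p : K) (w : F) : ∀ᶠ q in 𝓝 p, ∃ z : F, mfderivInChart (E := E) (F := F) ι p q z
      = endoInChart J (ι p) (ι q) (mfderivInChart (E := E) (F := F) ι p q w) := by
  filter_upwards [eventually_mem_baseSet hK.contMDiff p] with q hq
  let w' : TangentSpace 𝓘(ℝ, F) q :=
    (trivializationAt F (TangentSpace 𝓘(ℝ, F) : K → Type _) p).symmL ℝ q w
  obtain ⟨z, hz⟩ := hK.map_mem q (mfderiv 𝓘(ℝ, F) 𝓘(ℝ, E) ι q w') ⟨w', rfl⟩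
  have hw' : (trivializationAt F (TangentSpace 𝓘(ℝ, F) : K → Type _) p).continuousLinearMapAt ℝ q w'
      = w := Trivialization.continuousLinearMapAt_symmL _ hq.1 w
  refine ⟨(trivializationAt F (TangentSpace 𝓘(ℝ, F) : K → Type _) p).continuousLinearMapAt ℝ q z, ?_⟩
  rw [← continuousLinearMapAt_mfderiv hq.1]
  refine (congrArg ((trivializationAt E (TangentSpace 𝓘(ℝ, E) : M → Type _)
    (ι p)).continuousLinearMapAt ℝ (ι q)) hz).trans ?_
  rw [continuousLinearMapAt_endo hq.2, continuousLinearMapAt_mfderiv hq.1, hw']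

/-- Differentiating the condition that the tangent spaces of `K` are `J`-invariant. -/
theorem IsComplexSubmanifold.exists_secondDeriv_add (hJ : IsComplexStructure J)
    (hK : IsComplexSubmanifold F J ι) {p : K} (v w j : TangentSpace 𝓘(ℝ, F) p)
    (hj : mfderiv 𝓘(ℝ, F) 𝓘(ℝ, E) ι p j = J (ι p) (mfderiv 𝓘(ℝ, F) 𝓘(ℝ, E) ι p w)) :
    ∃ z : TangentSpace 𝓘(ℝ, F) p,
      secondDeriv (E := E) (F := F) ι p v j + mfderiv 𝓘(ℝ, F) 𝓘(ℝ, E) ι p z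
        = endoDeriv J (ι p) (mfderiv 𝓘(ℝ, F) 𝓘(ℝ, E) ι p v) (mfderiv 𝓘(ℝ, F) 𝓘(ℝ, E) ι p w)
          + J (ι p) (secondDeriv (E := E) (F := F) ι p v w) := by
  have : CompleteSpace E := FiniteDimensional.complete ℝ E
  have : CompleteSpace F := FiniteDimensional.complete ℝ F
  set S : K → F →L[ℝ] E := mfderivInChart (E := E) (F := F) ι p
  have dS : MDiffAt S p := mdifferentiableAt_mfderivInChart hK.contMDiff p
  have dι : MDiffAt ι p := (hK.contMDiff p).mdifferentiableAt (by simp)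
  have dJ0 := hJ.mdifferentiableAt_endoInChart (ι p)
  have dJ : MDiffAt (fun q ↦ endoInChart J (ι p) (ι q)) p := dJ0.comp p dι
  have hSp : ∀ u, S p u = mfderiv 𝓘(ℝ, F) 𝓘(ℝ, E) ι p u := mfderivInChart_self p
  have hinj : Function.Injective (S p) := fun a b hab ↦
    hK.injective_mfderiv p (by rwa [hSp, hSp] at hab)
  -- Pointwise J-invariance only gives some coefficient vector at each q. A left inverse L of S p
  -- makes L ∘ S q invertible near p, so that vector must be (L S_q)⁻¹ L J S_q w, which is
  -- differentiable in q.
  obtain ⟨L0, hL0⟩ := (S p).toLinearMap.exists_leftInverse_of_injective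
    (LinearMap.ker_eq_bot.2 hinj)
  let L : E →L[ℝ] F := L0.toContinuousLinearMap
  have hL : L ∘L S p = 1 := by
    ext u
    exact congrArg (fun f : F →ₗ[ℝ] F ↦ f u) hL0
  have dJS : MDiffAt (fun q ↦ endoInChart J (ι p) (ι q) (S q w)) p :=
    dJ.clm_apply (dS.clm_apply mdifferentiableAt_const)
  let y : K → F := fun q ↦ Ring.inverse (L ∘L S q) (L (endoInChart J (ι p) (ι q) (S q w)))
  have dLS : MDiffAt (fun q ↦ L ∘L S q) p := mdifferentiableAt_const.clm_comp dS
  have dinv : MDiffAt (fun q ↦ Ring.inverse (L ∘L S q)) p := by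
    refine DifferentiableAt.comp_mdifferentiableAt (g := Ring.inverse) ?_ dLS
    rw [hL]
    exact ((contDiffAt_ringInverse ℝ (1 : (F →L[ℝ] F)ˣ) (n := 1))).differentiableAt (by simp)
  have dy : MDiffAt y p := dinv.clm_apply (mdifferentiableAt_const.clm_apply dJS)
  have hunit : ∀ᶠ q in 𝓝 p, IsUnit (L ∘L S q) :=
    dLS.continuousAt.eventually (by
      simp only [hL]
      exact Units.isOpen.mem_nhds (1 : (F →L[ℝ] F)ˣ).isUnit)
  have hy : (fun q ↦ S q (y q)) =ᶠ[𝓝 p] fun q ↦ endoInChart J (ι p) (ι q) (S q w) := by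
    filter_upwards [hunit, hK.eventually_exists_mfderivInChart p w] with q hu ⟨z, hz⟩
    have : y q = z := by
      change Ring.inverse (L ∘L S q) (L (endoInChart J (ι p) (ι q) (S q w))) = z
      rw [← hz]
      exact congrArg (fun f : F →L[ℝ] F ↦ f z) (Ring.inverse_mul_cancel _ hu)
    rw [this, hz]
  have hyp : y p = j := by
    change Ring.inverse (L ∘L S p) (L (endoInChart J (ι p) (ι p) (S p w))) = j
    have h1 : endoInChart J (ι p) (ι p) (S p w) = S p j := by
      rw [hSp j, hj, hSp w]
      exact endoInChart_self _ _
    rw [h1, hL, Ring.inverse_one]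
    exact congrArg (fun f : F →L[ℝ] F ↦ f j) hL
  -- Differentiate S(q) y(q) = J(ι q) S(q) w along v. On the left the derivative of y contributes
  -- the tangent vector dι(dy(v)), which is the witness.
  have key := congrArg (fun f : F →L[ℝ] E ↦ f v) (mvfderiv_congr hy)
  -- Here w becomes a fixed element of the model space, so that it is a constant function of q.
  obtain ⟨w', hw'⟩ : ∃ w' : F, w' = w := ⟨w, rfl⟩
  rw [← hw'] at key
  have e1 := mvfderiv_clm_apply dS dy v
  have e2 := mvfderiv_clm_apply dJ (dS.clm_apply (mdifferentiableAt_const (c := w'))) v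
  have e3 := mvfderiv_clm_apply dS (mdifferentiableAt_const (c := w')) v
  have e4 : d% (fun q ↦ endoInChart J (ι p) (ι q)) p v
      = d% (endoInChart J (ι p)) (ι p) (mfderiv 𝓘(ℝ, F) 𝓘(ℝ, E) ι p v) :=
    congrArg (fun f : F →L[ℝ] E →L[ℝ] E ↦ f v) (dJ0.hasMFDerivAt.comp p dι.hasMFDerivAt).mfderiv
  rw [mvfderiv_const, _root_.zero_apply, map_zero, add_zero] at e3
  rw [e3, e4] at e2
  have main := (e1.symm.trans key).trans e2
  simp only [secondDeriv, endoDeriv, symmL_self]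
  refine ⟨d% y p v, ?_⟩
  rw [hyp] at main
  subst hw'
  exact (congrArg (fun u : E ↦ (d% S p v j : E) + u) (hSp _)).symm.trans
    (main.trans (congrArg₂ (fun a b : E ↦ a + b) (congrArg _ (hSp _)) (endoInChart_self _ _)))

end Tangency

/-! ### The second fundamental form in coordinates -/

section Along
variable {E : Type*} [NormedAddCommGroup E] [NormedSpace ℝ E] [FiniteDimensional ℝ E]
  {M : Type*} [TopologicalSpace M] [ChartedSpace E M] [IsManifold 𝓘(ℝ, E) ∞ M]
  [RiemannianBundle (fun x : M ↦ TangentSpace 𝓘(ℝ, E) x)]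
  [IsContMDiffRiemannianBundle 𝓘(ℝ, E) ∞ E (fun x : M ↦ TangentSpace 𝓘(ℝ, E) x)]
  {F : Type*} [NormedAddCommGroup F] [NormedSpace ℝ F]
  {K : Type*} [TopologicalSpace K] [ChartedSpace F K] [IsManifold 𝓘(ℝ, F) ∞ K]
  {ι : K → M}

/-- Near p the field dι(W) reads as q ↦ S(q)w with w constant, where S is dι in the charts, so its
derivative is the second derivative of ι. -/
theorem covariantDerivAlong_mfderiv_extend (hι : ContMDiff 𝓘(ℝ, F) 𝓘(ℝ, E) ∞ ι) {p : K}
    (v w : TangentSpace 𝓘(ℝ, F) p) :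
    covariantDerivAlong ι (fun q ↦ mfderiv 𝓘(ℝ, F) 𝓘(ℝ, E) ι q (extend F w q)) p v
      = secondDeriv (E := E) (F := F) ι p v w
        + leviCivita (extend E (mfderiv 𝓘(ℝ, F) 𝓘(ℝ, E) ι p w)) (ι p)
          (mfderiv 𝓘(ℝ, F) 𝓘(ℝ, E) ι p v) := by
  obtain ⟨w', hw'⟩ : ∃ w' : F, w' = w := ⟨w, rfl⟩
  have hev : (fun q ↦ (trivializationAt E (TangentSpace 𝓘(ℝ, E) : M → Type _) (ι p)
      ⟨ι q, mfderiv 𝓘(ℝ, F) 𝓘(ℝ, E) ι q (extend F w q)⟩).2) =ᶠ[𝓝 p]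
      fun q ↦ mfderivInChart (E := E) (F := F) ι p q w' := by
    filter_upwards [eventually_mem_baseSet hι p] with q hq
    rw [← Trivialization.continuousLinearMapAt_apply_of_mem (R := ℝ) _ hq.2,
      continuousLinearMapAt_mfderiv hq.1, extend_apply_eq_symmL _ hq.1, hw']
    exact congrArg _ (Trivialization.continuousLinearMapAt_symmL _ hq.1 w)
  rw [covariantDerivAlong]
  simp only [_root_.add_apply, ContinuousLinearMap.comp_apply]
  rw [mvfderiv_congr hev, mvfderiv_clm_apply (mdifferentiableAt_mfderivInChart hι p)
    mdifferentiableAt_const, mvfderiv_const, extend_apply_self, secondDeriv]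
  simp [hw']

theorem secondFundamentalForm_eq (hι : ContMDiff 𝓘(ℝ, F) 𝓘(ℝ, E) ∞ ι) {p : K}
    (v w : TangentSpace 𝓘(ℝ, F) p) :
    secondFundamentalForm F ι p v w = normalPart F ι p (secondDeriv (E := E) (F := F) ι p v w
        + leviCivita (extend E (mfderiv 𝓘(ℝ, F) 𝓘(ℝ, E) ι p w)) (ι p)
          (mfderiv 𝓘(ℝ, F) 𝓘(ℝ, E) ι p v)) := by
  rw [secondFundamentalForm, covariantDerivAlong_mfderiv_extend hι]

/-- Both D²ι and the Christoffel term are symmetric. Linearity in the second slot, not visible from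
the definition, is deduced from this. -/
theorem secondFundamentalForm_comm (hι : ContMDiff 𝓘(ℝ, F) 𝓘(ℝ, E) ∞ ι) {p : K}
    (v w : TangentSpace 𝓘(ℝ, F) p) :
    secondFundamentalForm F ι p v w = secondFundamentalForm (E := E) F ι p w v := by
  rw [secondFundamentalForm_eq hι, secondFundamentalForm_eq hι, secondDeriv_comm hι,
    leviCivita_extend_comm]

theorem secondFundamentalForm_add_left {p : K} (v v' w : TangentSpace 𝓘(ℝ, F) p) :
    secondFundamentalForm (E := E) F ι p (v + v') w
      = secondFundamentalForm F ι p v w + secondFundamentalForm F ι p v' w := by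
  simp only [secondFundamentalForm, normalPart, map_add]

theorem secondFundamentalForm_smul_left {p : K} (c : ℝ) (v w : TangentSpace 𝓘(ℝ, F) p) :
    secondFundamentalForm (E := E) F ι p (c • v) w = c • secondFundamentalForm F ι p v w := by
  simp only [secondFundamentalForm, normalPart, map_smul]

/-- The second fundamental form as a bilinear map. -/
def secondFundamentalFormₗ (hι : ContMDiff 𝓘(ℝ, F) 𝓘(ℝ, E) ∞ ι) (p : K) :
    TangentSpace 𝓘(ℝ, F) p →ₗ[ℝ] TangentSpace 𝓘(ℝ, F) p →ₗ[ℝ] TangentSpace 𝓘(ℝ, E) (ι p) :=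
  LinearMap.mk₂ ℝ (secondFundamentalForm F ι p) secondFundamentalForm_add_left
    secondFundamentalForm_smul_left
    (fun v w w' ↦ by
      simp only [secondFundamentalForm_comm hι v, secondFundamentalForm_add_left])
    (fun c v w ↦ by
      simp only [secondFundamentalForm_comm hι v, secondFundamentalForm_smul_left])

end Along

/-- The trace of a bilinear map does not depend on the orthonormal basis. -/
theorem sum_bilin_orthonormalBasis {κ V X : Type*} [Fintype κ] [NormedAddCommGroup V]
    [InnerProductSpace ℝ V] [AddCommGroup X] [Module ℝ X] (b b' : OrthonormalBasis κ ℝ V)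
    (β : V →ₗ[ℝ] V →ₗ[ℝ] X) : ∑ i, β (b' i) (b' i) = ∑ i, β (b i) (b i) := by
  classical
  have h (i : κ) : β (b' i) (b' i)
      = ∑ k, ∑ l, (⟪b k, b' i⟫_ℝ * ⟪b' i, b l⟫_ℝ) • β (b k) (b l) := by
    conv_lhs => rw [← b.sum_repr' (b' i)]
    simp only [map_sum, map_smul, LinearMap.sum_apply, LinearMap.smul_apply, Finset.smul_sum,
      smul_smul]
    rw [Finset.sum_comm]
    refine Finset.sum_congr rfl fun k _ ↦ Finset.sum_congr rfl fun l _ ↦ ?_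
    rw [real_inner_comm (b' i) (b l), mul_comm]
  simp_rw [h]
  rw [Finset.sum_comm]
  refine Finset.sum_congr rfl fun k _ ↦ ?_
  rw [Finset.sum_comm]
  -- Parseval for b' collapses the coefficient of β(b k, b l) to ⟪b k, b l⟫, which is the Kronecker
  -- delta.
  simp_rw [← Finset.sum_smul, b'.sum_inner_mul_inner]
  simp [orthonormal_iff_ite.1 b.orthonormal]

/-! ### The trace of the second fundamental form -/

section Submanifold
variable {E : Type*} [NormedAddCommGroup E] [NormedSpace ℝ E] [FiniteDimensional ℝ E]
  {M : Type*} [TopologicalSpace M] [ChartedSpace E M] [IsManifold 𝓘(ℝ, E) ∞ M]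
  [RiemannianBundle (fun x : M ↦ TangentSpace 𝓘(ℝ, E) x)]
  [IsContMDiffRiemannianBundle 𝓘(ℝ, E) ∞ E (fun x : M ↦ TangentSpace 𝓘(ℝ, E) x)]
  {F : Type*} [NormedAddCommGroup F] [NormedSpace ℝ F] [FiniteDimensional ℝ F]
  {K : Type*} [TopologicalSpace K] [ChartedSpace F K] [IsManifold 𝓘(ℝ, F) ∞ K]
  {J : Π x : M, TangentSpace 𝓘(ℝ, E) x →L[ℝ] TangentSpace 𝓘(ℝ, E) x}
  {θ : Π x : M, TangentSpace 𝓘(ℝ, E) x →L[ℝ] ℝ} {ι : K → M}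

theorem inner_sharp_left (x : M) (v : TangentSpace 𝓘(ℝ, E) x) : ⟪sharp θ x, v⟫_ℝ = θ x v := by
  have : CompleteSpace (TangentSpace 𝓘(ℝ, E) x) := FiniteDimensional.complete ℝ _
  exact InnerProductSpace.toDual_symm_apply

theorem normalPart_congr {p : K} {u u' : TangentSpace 𝓘(ℝ, E) (ι p)}
    (h : ∀ ν ∈ (tangentImage F ι p)ᗮ, ⟪u, ν⟫_ℝ = ⟪u', ν⟫_ℝ) :
    normalPart F ι p u = normalPart F ι p u' := by
  rw [normalPart, normalPart, ← sub_eq_zero, ← map_sub,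
    Submodule.starProjection_apply_eq_zero_iff, Submodule.mem_orthogonal']
  intro ν hν
  rw [inner_sub_left, h ν hν, sub_self]

theorem sub_normalPart_mem (p : K) (u : TangentSpace 𝓘(ℝ, E) (ι p)) :
    normalPart F ι p u - u ∈ tangentImage F ι p := by
  rw [normalPart, Submodule.starProjection_orthogonal', ← neg_sub, ← Submodule.neg_mem_iff]
  simp

/-- `A(v, v) + A(Jv, Jv) = -|v|² B^⊥`. -/
theorem secondFundamentalForm_add_map (hM : IsLocallyConformalKahler J θ)
    (hK : IsComplexSubmanifold F J ι) {p : K} {v j : TangentSpace 𝓘(ℝ, F) p}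
    (hj : mfderiv 𝓘(ℝ, F) 𝓘(ℝ, E) ι p j = J (ι p) (mfderiv 𝓘(ℝ, F) 𝓘(ℝ, E) ι p v)) :
    secondFundamentalForm F ι p v v + secondFundamentalForm F ι p j j
      = -⟪mfderiv 𝓘(ℝ, F) 𝓘(ℝ, E) ι p v, mfderiv 𝓘(ℝ, F) 𝓘(ℝ, E) ι p v⟫_ℝ
        • normalPart F ι p (sharp θ (ι p)) := by
  have hJ := hM.isComplexStructure
  -- J-invariance is differentiated in the direction v, then in the direction j. Applying J to the
  -- first relation and using the symmetry of D²ι eliminates the mixed term J D²ι(j, v).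
  obtain ⟨z₁, h₁⟩ := hK.exists_secondDeriv_add hJ v v j hj
  obtain ⟨z₂, h₂⟩ := hK.exists_secondDeriv_add hJ j v j hj
  have hsymm := secondDeriv_comm hK.contMDiff p j v
  rw [secondFundamentalForm_eq hK.contMDiff, secondFundamentalForm_eq hK.contMDiff]
  set a := mfderiv 𝓘(ℝ, F) 𝓘(ℝ, E) ι p v
  rw [hj] at h₂ ⊢
  have hat : a ∈ tangentImage F ι p := ⟨v, rfl⟩
  have hz₁ := hK.map_mem p _ (show mfderiv 𝓘(ℝ, F) 𝓘(ℝ, E) ι p z₁ ∈ tangentImage F ι p from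
    ⟨z₁, rfl⟩)
  have hz₂ : mfderiv 𝓘(ℝ, F) 𝓘(ℝ, E) ι p z₂ ∈ tangentImage F ι p := ⟨z₂, rfl⟩
  have e₁ := congrArg (J (ι p)) h₁
  rw [map_add, map_add, hJ.apply_apply, ← hsymm] at e₁
  have hsum : normalPart F ι p (secondDeriv (E := E) (F := F) ι p v v
        + leviCivita (extend E a) (ι p) a)
      + normalPart F ι p (secondDeriv (E := E) (F := F) ι p j j
        + leviCivita (extend E (J (ι p) a)) (ι p) (J (ι p) a))
      = normalPart F ι p ((leviCivita (extend E a) (ι p) a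
        + leviCivita (extend E (J (ι p) a)) (ι p) (J (ι p) a)
        + endoDeriv J (ι p) (J (ι p) a) a + J (ι p) (endoDeriv J (ι p) a a))
        - J (ι p) (mfderiv 𝓘(ℝ, F) 𝓘(ℝ, E) ι p z₁) - mfderiv 𝓘(ℝ, F) 𝓘(ℝ, E) ι p z₂) := by
    rw [normalPart, normalPart, ← map_add]
    refine congrArg _ ?_
    rw [eq_sub_of_add_eq h₂, eq_sub_of_add_eq e₁]
    abel
  rw [hsum, normalPart, normalPart, ← map_smul]
  refine normalPart_congr fun ν hν ↦ ?_
  have h0 {u : TangentSpace 𝓘(ℝ, E) (ι p)} (hu : u ∈ tangentImage F ι p) : ⟪u, ν⟫_ℝ = 0 :=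
    Submodule.inner_right_of_mem_orthogonal hu hν
  rw [inner_sub_left, inner_sub_left, h0 hz₁, h0 hz₂,
    hM.inner_leviCivita_extend (h0 hat) (h0 (hK.map_mem p a hat)), inner_smul_left,
    inner_sharp_left]
  simp

/-- Computing the trace once in an orthonormal basis b and once in Jb and adding pairs the terms as
A(v,v) + A(Jv,Jv) with |v| = 1; there are 2n such pairs. -/
theorem traceSecondFundamentalForm_eq (hM : IsLocallyConformalKahler J θ)
    (hK : IsComplexSubmanifold F J ι) {n : ℕ} (hn : Module.finrank ℝ F = 2 * n) (p : K) :
    traceSecondFundamentalForm F ι p = -(n : ℝ) • normalPart F ι p (sharp θ (ι p)) := by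
  let L : TangentSpace 𝓘(ℝ, F) p →ₗ[ℝ] TangentSpace 𝓘(ℝ, E) (ι p) :=
    (mfderiv 𝓘(ℝ, F) 𝓘(ℝ, E) ι p).toLinearMap
  let e : TangentSpace 𝓘(ℝ, F) p ≃ₗ[ℝ] LinearMap.range L :=
    LinearEquiv.ofInjective L (hK.injective_mfderiv p)
  have he (u : LinearMap.range L) : L (e.symm u) = u :=
    congrArg Subtype.val (e.apply_symm_apply u)
  let β : LinearMap.range L →ₗ[ℝ] LinearMap.range L →ₗ[ℝ] TangentSpace 𝓘(ℝ, E) (ι p) :=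
    (secondFundamentalFormₗ hK.contMDiff p).compl₁₂ e.symm.toLinearMap e.symm.toLinearMap
  let j : LinearMap.range L →ₗᵢ[ℝ] LinearMap.range L :=
    { toLinearMap := (J (ι p)).toLinearMap.restrict (hK.map_mem p)
      norm_map' := fun u ↦ by
        have h := hM.hermitian (ι p) u u
        rw [real_inner_self_eq_norm_sq, real_inner_self_eq_norm_sq] at h
        exact (sq_eq_sq₀ (norm_nonneg _) (norm_nonneg _)).1 h }
  let b := stdOrthonormalBasis ℝ (LinearMap.range L)
  let b' := b.map (j.toLinearIsometryEquiv rfl)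
  have htr : traceSecondFundamentalForm F ι p = ∑ i, β (b i) (b i) := by
    change ∑ i, secondFundamentalForm F ι p (b i).2.choose (b i).2.choose = _
    refine Finset.sum_congr rfl fun i _ ↦ ?_
    -- By injectivity of dι, the chosen preimage is the only one.
    have : (b i).2.choose = e.symm (b i) :=
      hK.injective_mfderiv p ((b i).2.choose_spec.trans (he (b i)).symm)
    rw [this]
    rfl
  have hpair (i) : β (b i) (b i) + β (b' i) (b' i) = -normalPart F ι p (sharp θ (ι p)) := by
    have hj : L (e.symm (b' i)) = J (ι p) (L (e.symm (b i))) := by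
      rw [he, he]
      rfl
    refine (secondFundamentalForm_add_map hM hK hj).trans ?_
    have h1 : ⟪L (e.symm (b i)), L (e.symm (b i))⟫_ℝ = 1 := by
      rw [he, ← Submodule.coe_inner, real_inner_self_eq_norm_sq, b.orthonormal.1 i, one_pow]
    change -⟪L (e.symm (b i)), L (e.symm (b i))⟫_ℝ • _ = _
    rw [h1, neg_one_smul]
  have hcard : Module.finrank ℝ (LinearMap.range L) = 2 * n := e.finrank_eq.symm.trans hn
  have htwo : (2 : ℝ) • traceSecondFundamentalForm F ι p
      = (2 : ℝ) • (-(n : ℝ) • normalPart F ι p (sharp θ (ι p))) := by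
    rw [two_smul]
    nth_rewrite 2 [htr]
    rw [htr, ← sum_bilin_orthonormalBasis b b' β]
    nth_rewrite 1 [sum_bilin_orthonormalBasis b b' β]
    rw [← Finset.sum_add_distrib, Finset.sum_congr rfl fun i _ ↦ hpair i, Finset.sum_const,
      Finset.card_univ, Fintype.card_fin, hcard, ← Nat.cast_smul_eq_nsmul ℝ, smul_neg, ← neg_smul,
      smul_smul]
    congr 1
    push_cast
    ring
  exact smul_right_injective _ (two_ne_zero' ℝ) htwo

end Submanifold

/-! ### Smoothness of the Lee vector field -/

section Sharp
variable {E : Type*} [NormedAddCommGroup E] [NormedSpace ℝ E] [FiniteDimensional ℝ E]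
  {M : Type*} [TopologicalSpace M] [ChartedSpace E M] [IsManifold 𝓘(ℝ, E) ∞ M]
  [RiemannianBundle (fun x : M ↦ TangentSpace 𝓘(ℝ, E) x)]
  [IsContMDiffRiemannianBundle 𝓘(ℝ, E) ∞ E (fun x : M ↦ TangentSpace 𝓘(ℝ, E) x)]
  {θ : Π x : M, TangentSpace 𝓘(ℝ, E) x →L[ℝ] ℝ}

/-- The metric in the chart at `x`. -/
def metricInChart (x y : M) : E →L[ℝ] E →L[ℝ] ℝ :=
  letI b := Module.finBasis ℝ E
  ∑ i, ∑ j, ⟪extend E (tangentOf x (b i)) y, extend E (tangentOf x (b j)) y⟫_ℝ •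
    (b.coord i).toContinuousLinearMap.smulRight (b.coord j).toContinuousLinearMap

theorem contMDiffAt_metricInChart (x : M) :
    CMDiffAt ∞ (metricInChart (E := E) x) x := by
  unfold metricInChart
  refine ContMDiffAt.sum fun i _ ↦ ContMDiffAt.sum fun j _ ↦ ?_
  have h : CMDiffAt ∞ (fun y ↦ ⟪extend E (tangentOf x (Module.finBasis ℝ E i)) y,
      extend E (tangentOf x (Module.finBasis ℝ E j)) y⟫_ℝ) x :=
    ContMDiffAt.inner_bundle (contMDiffAt_extend 𝓘(ℝ, E) E _) (contMDiffAt_extend 𝓘(ℝ, E) E _)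
  exact h.smul contMDiffAt_const

theorem metricInChart_apply {x y : M}
    (hy : y ∈ (trivializationAt E (TangentSpace 𝓘(ℝ, E) : M → Type _) x).baseSet) (u w : E) :
    metricInChart x y u w
      = ⟪(trivializationAt E (TangentSpace 𝓘(ℝ, E) : M → Type _) x).symmL ℝ y u,
        (trivializationAt E (TangentSpace 𝓘(ℝ, E) : M → Type _) x).symmL ℝ y w⟫_ℝ := by
  conv_rhs => rw [← (Module.finBasis ℝ E).sum_repr u, ← (Module.finBasis ℝ E).sum_repr w]
  simp only [map_sum, map_smul, sum_inner, inner_sum, inner_smul_left, inner_smul_right,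
    Finset.mul_sum]
  rw [Finset.sum_comm]
  simp only [metricInChart, _root_.sum_apply, _root_.smul_apply,
    ContinuousLinearMap.smulRight_apply]
  refine Finset.sum_congr rfl fun i _ ↦ Finset.sum_congr rfl fun j _ ↦ ?_
  rw [extend_apply_eq_symmL _ hy, extend_apply_eq_symmL _ hy]
  simp [tangentOf]
  ring

/-- Positive definiteness makes the map to the dual injective, and the dimensions agree. -/
theorem isInvertible_metricInChart {x y : M}
    (hy : y ∈ (trivializationAt E (TangentSpace 𝓘(ℝ, E) : M → Type _) x).baseSet) :
    (metricInChart (E := E) x y).IsInvertible := by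
  have hinj : Function.Injective (metricInChart (E := E) x y).toLinearMap := by
    rw [injective_iff_map_eq_zero]
    intro u hu
    have h1 := metricInChart_apply hy u u
    have h2 : metricInChart x y u = 0 := hu
    rw [h2, _root_.zero_apply, eq_comm, inner_self_eq_zero] at h1
    have h3 := Trivialization.continuousLinearMapAt_symmL (R := ℝ) _ hy u
    rw [← h3, h1, map_zero]
  have hrank : Module.finrank ℝ E = Module.finrank ℝ (E →L[ℝ] ℝ) := by
    rw [← (LinearMap.toContinuousLinearMap : (E →ₗ[ℝ] ℝ) ≃ₗ[ℝ] (E →L[ℝ] ℝ)).finrank_eq]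
    exact Subspace.dual_finrank_eq.symm
  exact ⟨(LinearEquiv.ofInjectiveOfFinrankEq _ hinj hrank).toContinuousLinearEquiv, rfl⟩

/-- The vector field dual to a locally exact 1-form is smooth. -/
theorem contMDiffAt_sharp {x : M} {f : M → ℝ} (hf : CMDiffAt ∞ f x)
    (hθ : ∀ᶠ y in 𝓝 x, θ y = d% f y) : CMDiffAt ∞ (T% (sharp θ)) x := by
  have : CompleteSpace E := FiniteDimensional.complete ℝ E
  rw [contMDiffAt_section]
  have hx := mem_baseSet_trivializationAt' (F := E) (E := (TangentSpace 𝓘(ℝ, E) : M → Type _)) x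
  have hbase := (trivializationAt E (TangentSpace 𝓘(ℝ, E) : M → Type _) x).open_baseSet.mem_nhds hx
  have hd : CMDiffAt ∞ (inTangentCoordinates 𝓘(ℝ, E) 𝓘(ℝ, ℝ) id f (mfderiv 𝓘(ℝ, E) 𝓘(ℝ, ℝ) f) x) x :=
    hf.mfderiv_const (by simp)
  have hinv : CMDiffAt ∞ (fun y ↦ (metricInChart (E := E) x y).inverse) x :=
    ((isInvertible_metricInChart hx).contDiffAt_map_inverse.contMDiffAt).comp x
      (contMDiffAt_metricInChart x)
  -- In coordinates the field is g⁻¹(df), and inversion is smooth at invertible maps.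
  refine (hinv.clm_apply hd).congr_of_eventuallyEq ?_
  filter_upwards [hbase, hθ] with y hy hθy
  rw [← Trivialization.continuousLinearMapAt_apply_of_mem (R := ℝ) _ hy, eq_comm,
    (isInvertible_metricInChart hy).inverse_apply_eq]
  ext w
  rw [metricInChart_apply hy, Trivialization.symmL_continuousLinearMapAt _ hy, inner_sharp_left,
    hθy]
  simp only [inTangentCoordinates, ContinuousLinearMap.inCoordinates, id,
    TangentBundle.continuousLinearMapAt_model_space]
  rfl

end Sharp

end

end LCK

theorem mainTheorem5
    {E : Type*} [NormedAddCommGroup E] [NormedSpace ℝ E] [FiniteDimensional ℝ E]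
    {M : Type*} [TopologicalSpace M] [ChartedSpace E M] [IsManifold 𝓘(ℝ, E) ∞ M]
    [RiemannianBundle (fun x : M ↦ TangentSpace 𝓘(ℝ, E) x)]
    [IsContMDiffRiemannianBundle 𝓘(ℝ, E) ∞ E (fun x : M ↦ TangentSpace 𝓘(ℝ, E) x)]
    (J : Π x : M, TangentSpace 𝓘(ℝ, E) x →L[ℝ] TangentSpace 𝓘(ℝ, E) x)
    (θ : Π x : M, TangentSpace 𝓘(ℝ, E) x →L[ℝ] ℝ)
    (hM : LCK.IsLocallyConformalKahler J θ)
    {F : Type*} [NormedAddCommGroup F] [NormedSpace ℝ F] [FiniteDimensional ℝ F]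
    {K : Type*} [TopologicalSpace K] [ChartedSpace F K] [IsManifold 𝓘(ℝ, F) ∞ K]
    (n : ℕ) (hn : Module.finrank ℝ F = 2 * n)
    (ι : K → M) (hK : LCK.IsComplexSubmanifold F J ι) :
    CMDiff ∞ (T% (fun x : M ↦ -(n : ℝ) • LCK.sharp θ x)) ∧
      LCK.IsVMinimal F ι (fun x : M ↦ -(n : ℝ) • LCK.sharp θ x) ∧
      ∀ p : K, LCK.traceSecondFundamentalForm F ι p
        = -(n : ℝ) • LCK.normalPart F ι p (LCK.sharp θ (ι p)) := by
  have htr := LCK.traceSecondFundamentalForm_eq hM hK hn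
  refine ⟨fun x ↦ ?_, fun p ↦ ?_, htr⟩
  · obtain ⟨U, hUo, hxU, f, hf, -, hθ⟩ := hM.locally_kahler x
    exact (LCK.contMDiffAt_sharp ((hf x hxU).contMDiffAt (hUo.mem_nhds hxU))
      (Filter.eventually_of_mem (hUo.mem_nhds hxU) hθ)).const_smul_section
  -- Here trace A - V = -n(B^⊥ - B), a multiple of a tangent vector.
  · rw [htr p, ← smul_sub]
    exact Submodule.smul_mem _ _ (LCK.sub_normalPart_mem p _)
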